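/- Let $R$ be an associative ring with identity and let $R\text{-Mod}$ be the category of left $R$-modules. Conventions: * For a class $\mathcal X$ of modules, $\mathcal X^{\perp}=\{N : \mathrm{Ext}^1_R(A,N)=0\ \forall A\in\mathcal X\}$ and ${}^{\perp}\mathcal X=\{M : \mathrm{Ext}^1_R(M,B)=0\ \forall B\in\mathcal X\}$. A pair $(\mathcal A,\mathcal B)$ of classes of modules is a *cotorsion pair* if $\mathcal A^{\perp}=\mathcal B$ and $\mathcal A={}^{\perp}\mathcal B$; it is *hereditary* if $\mathrm{Ext}^m_R(A,B)=0$ for all $A\in\mathcal A$, $B\in\mathcal B$, $m\ge 1$, and *complete* if every module $M$ admits short exact sequences $0\to B\to A\to M\to 0$ and $0\to M\to B'\to A'\to 0$ with $A,A'\in\mathcal A$ and $B,B'\in\mathcal B$. A triple $(\mathcal X,\mathcal Z,\mathcal Y)$ is a *complete hereditary cotorsion triple* if $(\mathcal X,\mathcal Z)$ and $(\mathcal Z,\mathcal Y)$ are complete hereditary cotorsion pairs (so $\mathcal Z=\mathcal X^{\perp}={}^{\perp}\mathcal Y$). * For a cotorsion pair $(\mathcal A,\mathcal B)$, let $\widetilde{\mathcal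 A}$ (resp. $\widetilde{\mathcal B}$) be the class of exact complexes all of whose cycle modules lie in $\mathcal A$ (resp. $\mathcal B$). Then $\mathrm{dg}(\mathcal A)$ is the class of complexes $M^{\bullet}$ with all $M^k\in\mathcal A$ such that every morphism from $M^{\bullet}$ to a complex in $\widetilde{\mathcal B}$ is null-homotopic, and $\mathrm{dg}(\mathcal B)$ is the class of complexes $M^{\bullet}$ with all $M^k\in\mathcal B$ such that every morphism from a complex in $\widetilde{\mathcal A}$ to $M^{\bullet}$ is null-homotopic. * $\mathrm K(R\text{-Mod})$ is the homotopy category of complexes of $R$-modules, and for a class $\mathcal C$ of complexes $\mathrm K(\mathcal C)$ is the corresponding full subcategory of $\mathrm K(R\text{-Mod})$. * $\mathcal X\text{-rac}$ is the class of complexes $K^{\bullet}$ such that $\mathrm{Hom}_R(A,K^{\bullet})$ is exact for all $A\in\mathcal X$, and $\mathcal Y\text{-lac}$ is the class of complexes $K^{\bullet}$ such that $\mathrm{Hom}_R(K^{\bullet},B)$ is exact for all $B\in\mathcal Y$. The relative derived categories are the Verdier quotients $\mathbf D_{\mathcal X}(R\text{-Mod})=\mathrm K(R\text{-Mod})/\mathrm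 K(\mathcal X\text{-rac})$ and $\mathbf D_{\mathcal Y}(R\text{-Mod})=\mathrm K(R\text{-Mod})/\mathrm K(\mathcal Y\text{-lac})$. **Theorem.** 1. If $(\mathcal X,\mathcal X^{\perp})$ is a complete and hereditary cotorsion pair in $R\text{-Mod}$, then there is a triangle-equivalence $\mathrm K(\mathrm{dg}(\mathcal X))\simeq \mathbf D_{\mathcal X}(R\text{-Mod})$, where $\mathrm{dg}(\mathcal X)$ is formed with respect to $(\mathcal X,\mathcal X^{\perp})$. 2. If $({}^{\perp}\mathcal Y,\mathcal Y)$ is a complete and hereditary cotorsion pair in $R\text{-Mod}$, then there is a triangle-equivalence $\mathrm K(\mathrm{dg}(\mathcal Y))\simeq \mathbf D_{\mathcal Y}(R\text{-Mod})$, where $\mathrm{dg}(\mathcal Y)$ is formed with respect to $({}^{\perp}\mathcal Y,\mathcal Y)$. 3. If $(\mathcal X,\mathcal Z,\mathcal Y)$ is a complete and hereditary cotorsion triple in $R\text{-Mod}$, then $\mathrm K(\mathcal X\text{-rac})=\mathrm K(\mathcal Y\text{-lac})$, hence $\mathbf D_{\mathcal X}(R\text{-Mod})=\mathbf D_{\mathcal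 Y}(R\text{-Mod})$, and there are triangle-equivalences $$\mathrm K(\mathrm{dg}(\mathcal X))\simeq\mathbf D_{\mathcal X}(R\text{-Mod})=\mathbf D_{\mathcal Y}(R\text{-Mod})\simeq\mathrm K(\mathrm{dg}(\mathcal Y)),$$ where $\mathrm{dg}(\mathcal X)$ is formed with respect to $(\mathcal X,\mathcal Z)$ and $\mathrm{dg}(\mathcal Y)$ with respect to $(\mathcal Z,\mathcal Y)$; in particular $\mathrm K(\mathrm{dg}(\mathcal X))$ and $\mathrm K(\mathrm{dg}(\mathcal Y))$ are triangle-equivalent. -/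

import Mathlib

open CategoryTheory Limits Pretriangulated

universe w v u v' u'

namespace RelDer

noncomputable section

/-! ### Triangulated categories and triangle-equivalences -/

/-- A triangulated category, bundled with all of its structure. -/
structure TriangCat where
  carrier : Type u
  [category : Category.{v} carrier]
  [preadditive : Preadditive carrier]
  [hasZeroObject : HasZeroObject carrier]
  [hasShift : HasShift carrier ℤ]
  [shiftAdditive : ∀ n : ℤ, (shiftFunctor carrier n).Additive]
  [pretriangulated : Pretriangulated carrier]
  [isTriangulated : IsTriangulated carrier]

attribute [instance] TriangCat.category TriangCat.preadditive TriangCat.hasZeroObject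
  TriangCat.hasShift TriangCat.shiftAdditive TriangCat.pretriangulated TriangCat.isTriangulated

/-- Two triangulated categories are triangle-equivalent if there is an equivalence of categories
between them which commutes with the shifts and preserves distinguished triangles. -/
def TriangleEquivalent (S : TriangCat.{v, u}) (T : TriangCat.{v', u'}) : Prop :=
  ∃ (F : S.carrier ⥤ T.carrier) (_ : F.CommShift ℤ), F.IsTriangulated ∧ F.IsEquivalence

section Triangulated

variable {D : Type u} [Category.{v} D] [Preadditive D] [HasZeroObject D] [HasShift D ℤ]
  [∀ n : ℤ, (shiftFunctor D n).Additive] [Pretriangulated D] [IsTriangulated D]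

/-- A triangulated subcategory, as a triangulated category. -/
def fullTriangSubcat (P : ObjectProperty D) [P.IsTriangulated] : TriangCat where
  carrier := P.FullSubcategory

/-- The Verdier quotient of a triangulated category by a triangulated subcategory `P`: the
localization at the morphisms whose cone is in `P`. -/
def verdierQuotient (P : ObjectProperty D) [P.IsTriangulated] : TriangCat where
  carrier := P.trW.Localization
  hasZeroObject := P.trW.Q.hasZeroObject_of_additive

end Triangulated

section Abelian

variable {C : Type u} [Category.{v} C] [Abelian C]

/-! ### Cotorsion pairs -/

section Cotorsion

variable [HasExt.{w} C]

/-- The class `X^⊥` of all `N` with `Ext¹(A, N) = 0` for all `A` in `X`. -/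
def rightPerp (X : ObjectProperty C) : ObjectProperty C :=
  fun N => ∀ A, X A → Subsingleton (Abelian.Ext.{w} A N 1)

/-- The class `^⊥Y` of all `M` with `Ext¹(M, B) = 0` for all `B` in `Y`. -/
def leftPerp (Y : ObjectProperty C) : ObjectProperty C :=
  fun M => ∀ B, Y B → Subsingleton (Abelian.Ext.{w} M B 1)

/-- `(X, Y)` is a cotorsion pair. -/
structure IsCotorsionPair (X Y : ObjectProperty C) : Prop where
  rightPerp_eq : rightPerp.{w} X = Y
  eq_leftPerp : X = leftPerp.{w} Y

/-- `(X, Y)` is a complete and hereditary cotorsion pair. -/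
structure IsCompleteHereditaryCotorsionPair (X Y : ObjectProperty C) : Prop
    extends IsCotorsionPair.{w} X Y where
  hereditary : ∀ A B, X A → Y B → ∀ m : ℕ, 1 ≤ m → Subsingleton (Abelian.Ext.{w} A B m)
  complete_left : ∀ M : C, ∃ (B A : C) (i : B ⟶ A) (p : A ⟶ M) (z : i ≫ p = 0),
    (ShortComplex.mk i p z).ShortExact ∧ X A ∧ Y B
  complete_right : ∀ M : C, ∃ (B A : C) (i : M ⟶ B) (p : B ⟶ A) (z : i ≫ p = 0),
    (ShortComplex.mk i p z).ShortExact ∧ X A ∧ Y B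

/-- `(X, Z, Y)` is a complete and hereditary cotorsion triple. -/
structure IsCompleteHereditaryCotorsionTriple (X Z Y : ObjectProperty C) : Prop where
  left : IsCompleteHereditaryCotorsionPair.{w} X Z
  right : IsCompleteHereditaryCotorsionPair.{w} Z Y

end Cotorsion

/-! ### Classes of complexes -/

/-- The class of exact complexes all of whose cycle objects are in `P`. -/
def tildeClass (P : ObjectProperty C) : ObjectProperty (CochainComplex C ℤ) :=
  fun M => M.Acyclic ∧ ∀ k : ℤ, P (M.cycles k)

/-- For a cotorsion pair `(X, Y)`, the class `dg(X)` of complexes with components in `X` such that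
every morphism to an exact complex with cycles in `Y` is null-homotopic. -/
def dgLeft (X Y : ObjectProperty C) : ObjectProperty (CochainComplex C ℤ) :=
  fun M => (∀ k : ℤ, X (M.X k)) ∧
    ∀ N : CochainComplex C ℤ, tildeClass Y N → ∀ f : M ⟶ N, Nonempty (Homotopy f 0)

/-- For a cotorsion pair `(X, Y)`, the class `dg(Y)` of complexes with components in `Y` such that
every morphism from an exact complex with cycles in `X` is null-homotopic. -/
def dgRight (X Y : ObjectProperty C) : ObjectProperty (CochainComplex C ℤ) :=
  fun M => (∀ k : ℤ, Y (M.X k)) ∧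
    ∀ N : CochainComplex C ℤ, tildeClass X N → ∀ f : N ⟶ M, Nonempty (Homotopy f 0)

/-- The class of right `X`-acyclic complexes: `Hom(A, K)` is exact for all `A` in `X`. -/
def rac (X : ObjectProperty C) : ObjectProperty (CochainComplex C ℤ) :=
  fun K => ∀ A, X A → ∀ i j k : ℤ, i + 1 = j → j + 1 = k →
    Function.Exact (fun g : A ⟶ K.X i => g ≫ K.d i j) (fun g : A ⟶ K.X j => g ≫ K.d j k)

/-- The class of left `Y`-acyclic complexes: `Hom(K, B)` is exact for all `B` in `Y`. -/
def lac (Y : ObjectProperty C) : ObjectProperty (CochainComplex C ℤ) :=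
  fun K => ∀ B, Y B → ∀ i j k : ℤ, i + 1 = j → j + 1 = k →
    Function.Exact (fun g : K.X k ⟶ B => K.d j k ≫ g) (fun g : K.X j ⟶ B => K.d i j ≫ g)

/-- The homotopy subcategory `K(P)` of `K(C)` given by a class `P` of complexes. -/
def homotopySubcat (P : ObjectProperty (CochainComplex C ℤ)) :
    ObjectProperty (HomotopyCategory C (ComplexShape.up ℤ)) :=
  fun K => P K.as

/-! ### These homotopy subcategories are triangulated -/

lemma tildeClass_shift (P : ObjectProperty C) (hP : P.IsClosedUnderIsomorphisms)
    (M : CochainComplex C ℤ) (hM : tildeClass P M) (n : ℤ) : tildeClass P (M⟦n⟧) := by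
  let e (k : ℤ) := (CochainComplex.shiftShortComplexFunctorIso C n k (n + k) rfl).app M
  refine ⟨fun k => ?_, fun k => ?_⟩
  · exact (ShortComplex.exact_iff_of_iso (e k)).2 (hM.1 (n + k))
  · exact P.prop_of_iso (ShortComplex.cyclesMapIso (e k)).symm (hM.2 (n + k))

lemma homotopySubcat_shift (P : ObjectProperty (CochainComplex C ℤ))
    (hP : ∀ (M : CochainComplex C ℤ) (n : ℤ), P M → P (M⟦n⟧)) :
    (homotopySubcat P).IsStableUnderShift ℤ where
  isStableUnderShiftBy n := ⟨fun K hK => by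
    obtain ⟨M, rfl⟩ := HomotopyCategory.quotient_obj_surjective K
    change homotopySubcat P (((HomotopyCategory.quotient C (.up ℤ)).obj M)⟦n⟧)
    rw [HomotopyCategory.shift_quotient_obj]
    exact hP M n hK⟩

open ZeroObject in
/-- Termwise conditions which are additive define triangulated subcategories of `K(C)`. -/
lemma isTriangulated_termwise (X : ObjectProperty C) (hX : X.IsClosedUnderIsomorphisms)
    (h0 : ∀ Z, IsZero Z → X Z) (hadd : ∀ A B, X A → X B → X (A ⊞ B)) :
    (homotopySubcat (fun M : CochainComplex C ℤ => ∀ k : ℤ, X (M.X k))).IsTriangulated := by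
  have hs : (homotopySubcat (fun M : CochainComplex C ℤ => ∀ k : ℤ, X (M.X k))).IsStableUnderShift
      ℤ := homotopySubcat_shift _ (fun M n hM k => hM (k + n))
  have hz : IsZero ((HomotopyCategory.quotient C (ComplexShape.up ℤ)).obj
      ((HomologicalComplex.single C (ComplexShape.up ℤ) 0).obj (0 : C))) :=
    Functor.map_isZero _ (Functor.map_isZero _ (isZero_zero _))
  refine { exists_zero := ⟨_, hz, fun k => ?_⟩, ext₂' := fun T hT h₁ h₃ => ?_ }
  · exact h0 _ ((HomologicalComplex.eval C (ComplexShape.up ℤ) k).map_isZero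
      ((HomologicalComplex.single C (ComplexShape.up ℤ) 0).map_isZero (isZero_zero C)))
  · have hT' := inv_rot_of_distTriang _ hT
    have h₃' := ObjectProperty.le_shift _ (-1 : ℤ) _ h₃
    obtain ⟨K, hK⟩ := HomotopyCategory.quotient_obj_surjective T.invRotate.obj₁
    obtain ⟨L, hL⟩ := HomotopyCategory.quotient_obj_surjective T.invRotate.obj₂
    obtain ⟨f, hf⟩ := (HomotopyCategory.quotient C (ComplexShape.up ℤ)).map_surjective
      (eqToHom hK ≫ T.invRotate.mor₁ ≫ eqToHom hL.symm)
    have hc := HomotopyCategory.mappingCone_triangleh_distinguished f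
    refine ⟨(HomotopyCategory.quotient C _).obj (CochainComplex.mappingCone f), fun k => ?_, ?_⟩
    · refine X.prop_of_iso
        (HomologicalComplex.homotopyCofiber.XIsoBiprod f k (k + 1) rfl).symm ?_
      refine hadd _ _ ?_ ?_
      · have : homotopySubcat (fun M : CochainComplex C ℤ => ∀ k : ℤ, X (M.X k))
          ((HomotopyCategory.quotient C (ComplexShape.up ℤ)).obj K) := by rw [hK]; exact h₃'
        exact this (k + 1)
      · have : homotopySubcat (fun M : CochainComplex C ℤ => ∀ k : ℤ, X (M.X k))
          ((HomotopyCategory.quotient C (ComplexShape.up ℤ)).obj L) := by rw [hL]; exact h₁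
        exact this k
    · obtain ⟨e, -⟩ := exists_iso_of_arrow_iso _ _ hT' hc
        (Arrow.isoMk (eqToIso hK.symm) (eqToIso hL.symm) (by
          have : eqToHom hK.symm ≫ (HomotopyCategory.quotient C (ComplexShape.up ℤ)).map f =
              T.invRotate.mor₁ ≫ eqToHom hL.symm := by
            rw [hf, ← Category.assoc, eqToHom_trans, eqToHom_refl, Category.id_comp]
          exact this))
      exact ⟨Triangle.π₃.mapIso e⟩

lemma homotopy_iff (M N : CochainComplex C ℤ) (f : M ⟶ N) :
    Nonempty (Homotopy f 0) ↔ (HomotopyCategory.quotient C (ComplexShape.up ℤ)).map f = 0 := by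
  constructor
  · rintro ⟨h⟩
    rw [HomotopyCategory.eq_of_homotopy _ _ h, Functor.map_zero]
  · intro h
    exact ⟨HomotopyCategory.homotopyOfEq _ _ (by rw [h, Functor.map_zero])⟩

lemma homotopySubcat_dgLeft (X Y : ObjectProperty C) :
    homotopySubcat (dgLeft X Y) =
      homotopySubcat (fun M : CochainComplex C ℤ => ∀ k : ℤ, X (M.X k)) ⊓
        (homotopySubcat (tildeClass Y)).leftOrthogonal := by
  ext K
  obtain ⟨M, rfl⟩ := HomotopyCategory.quotient_obj_surjective K
  refine and_congr Iff.rfl ⟨fun h L f hL => ?_, fun h N hN f => ?_⟩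
  · obtain ⟨N, rfl⟩ := HomotopyCategory.quotient_obj_surjective L
    obtain ⟨g, rfl⟩ := (HomotopyCategory.quotient C (ComplexShape.up ℤ)).map_surjective f
    exact (homotopy_iff _ _ _).1 (h N hL g)
  · exact (homotopy_iff _ _ _).2 (h _ hN)

lemma homotopySubcat_dgRight (X Y : ObjectProperty C) :
    homotopySubcat (dgRight X Y) =
      homotopySubcat (fun M : CochainComplex C ℤ => ∀ k : ℤ, Y (M.X k)) ⊓
        (homotopySubcat (tildeClass X)).rightOrthogonal := by
  ext K
  obtain ⟨M, rfl⟩ := HomotopyCategory.quotient_obj_surjective K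
  refine and_congr Iff.rfl ⟨fun h L f hL => ?_, fun h N hN f => ?_⟩
  · obtain ⟨N, rfl⟩ := HomotopyCategory.quotient_obj_surjective L
    obtain ⟨g, rfl⟩ := (HomotopyCategory.quotient C (ComplexShape.up ℤ)).map_surjective f
    exact (homotopy_iff _ _ _).1 (h N hL g)
  · exact (homotopy_iff _ _ _).2 (h _ hN)

section Perp

variable [HasExt.{w} C]

lemma leftPerp_iso (Y : ObjectProperty C) :
    (leftPerp.{w} Y).IsClosedUnderIsomorphisms where
  of_iso {_ M'} e h B hB := by
    have := h B hB
    refine ⟨fun a b => ?_⟩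
    have key (c : Abelian.Ext.{w} M' B 1) : c = 0 := by
      have := Subsingleton.elim ((Abelian.Ext.mk₀ e.hom).comp c (zero_add 1)) 0
      have := congrArg (fun x => (Abelian.Ext.mk₀ e.inv).comp x (zero_add 1)) this
      simpa using this
    rw [key a, key b]

lemma rightPerp_iso (X : ObjectProperty C) :
    (rightPerp.{w} X).IsClosedUnderIsomorphisms where
  of_iso {_ M'} e h A hA := by
    have := h A hA
    refine ⟨fun a b => ?_⟩
    have key (c : Abelian.Ext.{w} A M' 1) : c = 0 := by
      have := Subsingleton.elim (c.comp (Abelian.Ext.mk₀ e.inv) (add_zero 1)) 0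
      have := congrArg (fun x => x.comp (Abelian.Ext.mk₀ e.hom) (add_zero 1)) this
      simpa using this
    rw [key a, key b]

lemma leftPerp_zero (Y : ObjectProperty C) (Z : C) (hZ : IsZero Z) : leftPerp.{w} Y Z := by
  intro B _
  have key (c : Abelian.Ext.{w} Z B 1) : c = 0 := by
    rw [← Abelian.Ext.mk₀_id_comp c, hZ.eq_of_src (𝟙 Z) 0]
    simp
  exact ⟨fun a b => by rw [key a, key b]⟩

lemma rightPerp_zero (X : ObjectProperty C) (Z : C) (hZ : IsZero Z) : rightPerp.{w} X Z := by
  intro A _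
  have key (c : Abelian.Ext.{w} A Z 1) : c = 0 := by
    rw [← Abelian.Ext.comp_mk₀_id c, hZ.eq_of_src (𝟙 Z) 0]
    simp
  exact ⟨fun a b => by rw [key a, key b]⟩

lemma leftPerp_biprod (Y : ObjectProperty C) (A A' : C) (h : leftPerp.{w} Y A)
    (h' : leftPerp.{w} Y A') : leftPerp.{w} Y (A ⊞ A') := by
  intro B hB
  have := h B hB
  have := h' B hB
  exact Abelian.Ext.biprodAddEquiv.toEquiv.subsingleton

lemma rightPerp_biprod (X : ObjectProperty C) (B B' : C) (h : rightPerp.{w} X B)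
    (h' : rightPerp.{w} X B') : rightPerp.{w} X (B ⊞ B') := by
  intro A hA
  have := h A hA
  have := h' A hA
  exact Abelian.Ext.addEquivBiprod.toEquiv.subsingleton

variable {X Y : ObjectProperty C}

lemma isTriangulated_dgLeft (h : IsCotorsionPair.{w} X Y) :
    (homotopySubcat (dgLeft X Y)).IsTriangulated := by
  have := homotopySubcat_shift (tildeClass Y)
    (fun M n hM => tildeClass_shift Y (h.rightPerp_eq ▸ rightPerp_iso X) M hM n)
  have : (homotopySubcat (fun M : CochainComplex C ℤ => ∀ k : ℤ, X (M.X k))).IsTriangulated := by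
    rw [h.eq_leftPerp]
    exact isTriangulated_termwise _ (leftPerp_iso Y) (leftPerp_zero Y) (leftPerp_biprod Y)
  rw [homotopySubcat_dgLeft]
  infer_instance

lemma isTriangulated_dgRight (h : IsCotorsionPair.{w} X Y) :
    (homotopySubcat (dgRight X Y)).IsTriangulated := by
  have := homotopySubcat_shift (tildeClass X)
    (fun M n hM => tildeClass_shift X (h.eq_leftPerp ▸ leftPerp_iso Y) M hM n)
  have : (homotopySubcat (fun M : CochainComplex C ℤ => ∀ k : ℤ, Y (M.X k))).IsTriangulated := by
    rw [← h.rightPerp_eq]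
    exact isTriangulated_termwise _ (rightPerp_iso X) (rightPerp_zero X) (rightPerp_biprod X)
  rw [homotopySubcat_dgRight]
  infer_instance

end Perp

/-- The stalk complexes, in all degrees, on objects of `X` (up to isomorphism in `K(C)`). -/
def stalks (X : ObjectProperty C) : ObjectProperty (HomotopyCategory C (ComplexShape.up ℤ)) :=
  fun K => ∃ (A : C) (p : ℤ), X A ∧ Nonempty (K ≅ (HomotopyCategory.singleFunctor C p).obj A)

instance (X : ObjectProperty C) : (stalks X).IsStableUnderShift ℤ where
  isStableUnderShiftBy n := ⟨by
    rintro K ⟨A, p, hA, ⟨e⟩⟩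
    exact ⟨A, p - n, hA, ⟨(shiftFunctor _ n).mapIso e ≪≫
      ((HomotopyCategory.singleFunctors C).shiftIso n (p - n) p (by lia)).app A⟩⟩⟩

open CochainComplex.HomComplex in
lemma hom_eq_zero_iff (K L : CochainComplex C ℤ) :
    (∀ f : (HomotopyCategory.quotient C (ComplexShape.up ℤ)).obj K ⟶
      (HomotopyCategory.quotient C (ComplexShape.up ℤ)).obj L, f = 0) ↔
    ∀ c : Cocycle K L 0, c ∈ coboundaries K L 0 := by
  let e := (HomotopyCategory.quotient C (ComplexShape.up ℤ)).mapIso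
    ((shiftFunctorZero (CochainComplex C ℤ) ℤ).app L)
  constructor
  · intro h c
    rw [← CohomologyClass.toHom_mk_eq_zero_iff]
    have := h (CohomologyClass.toHom (CohomologyClass.mk c) ≫ e.hom)
    exact (cancel_mono e.hom).1 (this.trans zero_comp.symm)
  · intro h f
    obtain ⟨x, hx⟩ := (CohomologyClass.toHom_bijective K L 0).2 (f ≫ e.inv)
    obtain ⟨c, rfl⟩ := CohomologyClass.mk_surjective x
    rw [(CohomologyClass.toHom_mk_eq_zero_iff c).2 (h c)] at hx
    exact (cancel_mono e.inv).1 (hx.symm.trans zero_comp.symm)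

open CochainComplex.HomComplex in
lemma homotopySubcat_rac (X : ObjectProperty C) :
    homotopySubcat (rac X) = (stalks X).rightOrthogonal := by
  ext K
  obtain ⟨M, rfl⟩ := HomotopyCategory.quotient_obj_surjective K
  constructor
  · rintro h S f ⟨A, p, hA, ⟨e⟩⟩
    rw [← cancel_epi e.inv, comp_zero]
    refine (hom_eq_zero_iff ((CochainComplex.singleFunctor C p).obj A) M).2 (fun c => ?_) _
    obtain ⟨g, hg, rfl⟩ := Cocycle.fromSingleMk_surjective c p (add_zero p) (p + 1) rfl
    rw [Cocycle.fromSingleMk_mem_coboundaries_iff _ _ _ _ _ (p - 1) (by lia)]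
    exact (h A hA (p - 1) p (p + 1) (by lia) rfl g).1 hg
  · intro h A hA i j k hij hjk g
    constructor
    · intro hg
      refine (Cocycle.fromSingleMk_mem_coboundaries_iff (K := M) g (add_zero j) k hjk hg i hij).1 ?_
      exact (hom_eq_zero_iff ((CochainComplex.singleFunctor C j).obj A) M).1
        (fun f => h f ⟨A, j, hA, ⟨Iso.refl _⟩⟩) _
    · rintro ⟨a, rfl⟩
      simp

open CochainComplex.HomComplex in
lemma homotopySubcat_lac (Y : ObjectProperty C) :
    homotopySubcat (lac Y) = (stalks Y).leftOrthogonal := by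
  ext K
  obtain ⟨M, rfl⟩ := HomotopyCategory.quotient_obj_surjective K
  constructor
  · rintro h S f ⟨B, p, hB, ⟨e⟩⟩
    rw [← cancel_mono e.hom, zero_comp]
    refine (hom_eq_zero_iff M ((CochainComplex.singleFunctor C p).obj B)).2 (fun c => ?_) _
    obtain ⟨g, hg, rfl⟩ := Cocycle.toSingleMk_surjective c p (add_zero p) (p - 1) (by lia)
    rw [Cocycle.toSingleMk_mem_coboundaries_iff _ _ _ _ _ (p + 1) rfl]
    exact (h B hB (p - 1) p (p + 1) (by lia) rfl g).1 hg
  · intro h B hB i j k hij hjk g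
    constructor
    · intro hg
      refine (Cocycle.toSingleMk_mem_coboundaries_iff (K := M) g (add_zero j) i hij hg k hjk).1 ?_
      exact (hom_eq_zero_iff M ((CochainComplex.singleFunctor C j).obj B)).1
        (fun f => h f ⟨B, j, hB, ⟨Iso.refl _⟩⟩) _
    · rintro ⟨a, rfl⟩
      simp

instance isTriangulated_rac (X : ObjectProperty C) : (homotopySubcat (rac X)).IsTriangulated := by
  rw [homotopySubcat_rac]
  infer_instance

instance isTriangulated_lac (Y : ObjectProperty C) : (homotopySubcat (lac Y)).IsTriangulated := by
  rw [homotopySubcat_lac]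
  infer_instance

/-! ### The triangulated categories of the statement -/

/-- `K(dg(X))` for a cotorsion pair `(X, Y)`. -/
def KdgLeft [HasExt.{w} C] {X Y : ObjectProperty C} (h : IsCotorsionPair.{w} X Y) : TriangCat :=
  haveI := isTriangulated_dgLeft h
  fullTriangSubcat (homotopySubcat (dgLeft X Y))

/-- `K(dg(Y))` for a cotorsion pair `(X, Y)`. -/
def KdgRight [HasExt.{w} C] {X Y : ObjectProperty C} (h : IsCotorsionPair.{w} X Y) : TriangCat :=
  haveI := isTriangulated_dgRight h
  fullTriangSubcat (homotopySubcat (dgRight X Y))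

/-- The relative derived category `D_X(C) = K(C)/K(X-rac)`. -/
def relDerivedLeft (X : ObjectProperty C) : TriangCat :=
  verdierQuotient (homotopySubcat (rac X))

/-- The relative derived category `D_Y(C) = K(C)/K(Y-lac)`. -/
def relDerivedRight (Y : ObjectProperty C) : TriangCat :=
  verdierQuotient (homotopySubcat (lac Y))

end Abelian

end

end RelDer

namespace RelDer

noncomputable section

/-! ### Triangle-equivalences and Verdier quotients -/

universe v₁ u₁ v₂ u₂ v₃ u₃

/-! Statement 1 is a localization argument. In the homotopy category, dg(X) is left orthogonal to
the X-rac complexes (`CHPair.homotopy_zero_of_dgLeft`), which makes K(dg(X)) ⥤ D_X fully faithful.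
Every complex M also admits a map N ⟶ M with N in dg(X) and X-rac cone
(`CHPair.exists_dgLeft_precover`, `CHPair.rac_mappingCone`), which gives essential surjectivity.

Approximation: take a K-projective resolution P ⟶ M by projectives, with acyclic cone E. The
horseshoe lemma gives 0 ⟶ B ⟶ A ⟶ E ⟶ 0 with A in X-tilde and B in Y-tilde, where Y is the right
class of the pair (`CHPair.exists_tildeClass_precover`). Pulling back along M ⟶ E yields N with 0 ⟶
B ⟶ N ⟶ M ⟶ 0 and 0 ⟶ N ⟶ A ⟶ P[1] ⟶ 0. The second sequence puts N in dg(X), the first makes the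
cone of N ⟶ M X-rac.

Orthogonality: an X-rac complex E is acyclic, so it has such an A ⟶ E. Maps from dg(X) to E lift to
A, since the obstruction is a map to B[1]. Now A is X-rac because B and E are, and an X-rac complex
in X-tilde is contractible.

Statement 2 is statement 1 in the opposite category. For this reason everything is proved in abelian
categories, from the self-dual, Ext-free list `CHPair`.

For statement 3, X-rac = Y-lac is tested on the sequences of cycles: a short exact sequence that
stays exact under Hom(X, -) stays exact under Hom(-, Y), because the objects of Z ∩ Y are injective
(`exists_extension_of_triple`). The converse is dual. -/

lemma TriangleEquivalent.symm {S : TriangCat.{v₁, u₁}} {T : TriangCat.{v₂, u₂}}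
    (h : TriangleEquivalent S T) : TriangleEquivalent T S := by
  obtain ⟨F, hF, hF', hF''⟩ := h
  let E := F.asEquivalence
  let : E.functor.CommShift ℤ := hF
  let := E.commShiftInverse ℤ
  have : E.CommShift ℤ := E.commShift_of_functor ℤ
  have : E.IsTriangulated := Equivalence.IsTriangulated.mk' E hF'
  exact ⟨E.inverse, inferInstance, inferInstance, inferInstance⟩

lemma TriangleEquivalent.trans {S : TriangCat.{v₁, u₁}} {T : TriangCat.{v₂, u₂}}
    {U : TriangCat.{v₃, u₃}} (h : TriangleEquivalent S T) (h' : TriangleEquivalent T U) :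
    TriangleEquivalent S U := by
  obtain ⟨F, hF, hF', hF''⟩ := h
  obtain ⟨G, hG, hG', hG''⟩ := h'
  exact ⟨F ⋙ G, inferInstance, inferInstance, inferInstance⟩

section

variable {D : Type u} [Category.{v} D] [Preadditive D] [HasZeroObject D] [HasShift D ℤ]
  [∀ n : ℤ, (shiftFunctor D n).Additive] [Pretriangulated D] [IsTriangulated D]

lemma verdierQuotient_congr {P Q : ObjectProperty D} [P.IsTriangulated] [Q.IsTriangulated]
    (h : P = Q) : verdierQuotient P = verdierQuotient Q := by
  subst h
  rfl

/-- The composition `A ⥤ D ⥤ D/B`. -/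
def toVerdierQuotient (A B : ObjectProperty D) [A.IsTriangulated] [B.IsTriangulated] :
    A.FullSubcategory ⥤ B.trW.Localization := A.ι ⋙ B.trW.Q

lemma triangleEquivalent_of_isEquivalence (A B : ObjectProperty D) [A.IsTriangulated]
    [B.IsTriangulated] (h : (toVerdierQuotient A B).IsEquivalence) :
    TriangleEquivalent (fullTriangSubcat A) (verdierQuotient B) := by
  have : HasZeroObject B.trW.Localization := B.trW.Q.hasZeroObject_of_additive
  refine ⟨(A.ι ⋙ B.trW.Q : A.FullSubcategory ⥤ B.trW.Localization),
    (inferInstance : (A.ι ⋙ B.trW.Q).CommShift ℤ), ?_, h⟩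
  exact (inferInstance : (A.ι ⋙ B.trW.Q).IsTriangulated)

/-- If `A` is left orthogonal to `B` and every object has an approximation by `A` up to `B`,
then `A` is equivalent to the Verdier quotient by `B`. -/
lemma triangleEquivalent_of_leftOrthogonal (A B : ObjectProperty D) [A.IsTriangulated]
    [B.IsTriangulated] (hAB : A ≤ B.leftOrthogonal)
    (happ : ∀ M : D, ∃ (P : D) (f : P ⟶ M), A P ∧ B.trW f) :
    TriangleEquivalent (fullTriangSubcat A) (verdierQuotient B) := by
  apply triangleEquivalent_of_isEquivalence
  -- Maps out of an object left orthogonal to `B` are unchanged when the morphisms with cone in `B`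
  -- are inverted, whatever their target.
  have hff (X Y : A.FullSubcategory) :
      Function.Bijective ((toVerdierQuotient A B).map : (X ⟶ Y) → _) :=
    (ObjectProperty.leftOrthogonal.map_bijective_of_isTriangulated (hAB _ X.property)
      B.trW.Q Y.obj).comp (A.fullyFaithfulι.map_bijective X Y)
  have : (toVerdierQuotient A B).Full := ⟨fun {X Y} => (hff X Y).2⟩
  have : (toVerdierQuotient A B).Faithful := ⟨fun {X Y} _ _ h => (hff X Y).1 h⟩
  have : (toVerdierQuotient A B).EssSurj := ⟨fun Z => by
    have := Localization.essSurj B.trW.Q B.trW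
    obtain ⟨P, f, hP, hf⟩ := happ (B.trW.Q.objPreimage Z)
    have : IsIso (B.trW.Q.map f) := Localization.inverts B.trW.Q B.trW f hf
    let e := asIso (B.trW.Q.map f)
    exact ⟨⟨P, hP⟩, ⟨e ≪≫ B.trW.Q.objObjPreimageIso Z⟩⟩⟩
  exact { }

/-- If `A` is right orthogonal to `B` and every object has an approximation by `A` up to `B`,
then `A` is equivalent to the Verdier quotient by `B`. -/
lemma triangleEquivalent_of_rightOrthogonal (A B : ObjectProperty D) [A.IsTriangulated]
    [B.IsTriangulated] (hAB : A ≤ B.rightOrthogonal)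
    (happ : ∀ M : D, ∃ (P : D) (f : M ⟶ P), A P ∧ B.trW f) :
    TriangleEquivalent (fullTriangSubcat A) (verdierQuotient B) := by
  apply triangleEquivalent_of_isEquivalence
  have hff (X Y : A.FullSubcategory) :
      Function.Bijective ((toVerdierQuotient A B).map : (X ⟶ Y) → _) :=
    (ObjectProperty.rightOrthogonal.map_bijective_of_isTriangulated (hAB _ Y.property)
      B.trW.Q X.obj).comp (A.fullyFaithfulι.map_bijective X Y)
  have : (toVerdierQuotient A B).Full := ⟨fun {X Y} => (hff X Y).2⟩
  have : (toVerdierQuotient A B).Faithful := ⟨fun {X Y} _ _ h => (hff X Y).1 h⟩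
  have : (toVerdierQuotient A B).EssSurj := ⟨fun Z => by
    have := Localization.essSurj B.trW.Q B.trW
    obtain ⟨P, f, hP, hf⟩ := happ (B.trW.Q.objPreimage Z)
    have : IsIso (B.trW.Q.map f) := Localization.inverts B.trW.Q B.trW f hf
    let e := asIso (B.trW.Q.map f)
    exact ⟨⟨P, hP⟩, ⟨e.symm ≪≫ B.trW.Q.objObjPreimageIso Z⟩⟩⟩
  exact { }

end

/-! ### Complete hereditary cotorsion pairs through lifting properties -/

section CHPair

variable {C : Type u} [Category.{v} C] [Abelian C]

/-- The consequences of being a complete hereditary cotorsion pair which do not mention `Ext`.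
This list of properties is self-dual. -/
structure CHPair (X Y : ObjectProperty C) : Prop where
  lift : ∀ {S : ShortComplex C}, S.ShortExact → Y S.X₁ → ∀ {A : C}, X A → ∀ f : A ⟶ S.X₃,
    ∃ g : A ⟶ S.X₂, g ≫ S.g = f
  extend : ∀ {S : ShortComplex C}, S.ShortExact → X S.X₃ → ∀ {B : C}, Y B → ∀ f : S.X₁ ⟶ B,
    ∃ g : S.X₂ ⟶ B, S.f ≫ g = f
  iso_left : X.IsClosedUnderIsomorphisms
  iso_right : Y.IsClosedUnderIsomorphisms
  ext_left : ∀ {S : ShortComplex C}, S.ShortExact → X S.X₁ → X S.X₃ → X S.X₂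
  ext_right : ∀ {S : ShortComplex C}, S.ShortExact → Y S.X₁ → Y S.X₃ → Y S.X₂
  ker_left : ∀ {S : ShortComplex C}, S.ShortExact → X S.X₂ → X S.X₃ → X S.X₁
  coker_right : ∀ {S : ShortComplex C}, S.ShortExact → Y S.X₁ → Y S.X₂ → Y S.X₃
  proj : ∀ P : C, Projective P → X P
  inj : ∀ I : C, Injective I → Y I
  complete_left : ∀ M : C, ∃ (B A : C) (i : B ⟶ A) (p : A ⟶ M) (z : i ≫ p = 0),
    (ShortComplex.mk i p z).ShortExact ∧ X A ∧ Y B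
  complete_right : ∀ M : C, ∃ (B A : C) (i : M ⟶ B) (p : B ⟶ A) (z : i ≫ p = 0),
    (ShortComplex.mk i p z).ShortExact ∧ X A ∧ Y B

open Opposite in
lemma CHPair.op {X Y : ObjectProperty C} (h : CHPair X Y) : CHPair Y.op X.op where
  lift {S} hS hX {A} hA f := by
    obtain ⟨g, hg⟩ := h.extend hS.unop hX hA f.unop
    exact ⟨g.op, Quiver.Hom.unop_inj hg⟩
  extend {S} hS hX {B} hB f := by
    obtain ⟨g, hg⟩ := h.lift hS.unop hX hB f.unop
    exact ⟨g.op, Quiver.Hom.unop_inj hg⟩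
  iso_left := have := h.iso_right; inferInstance
  iso_right := have := h.iso_left; inferInstance
  ext_left hS h₁ h₃ := h.ext_right hS.unop h₃ h₁
  ext_right hS h₁ h₃ := h.ext_left hS.unop h₃ h₁
  ker_left hS h₂ h₃ := h.coker_right hS.unop h₃ h₂
  coker_right hS h₁ h₂ := h.ker_left hS.unop h₂ h₁
  proj P hP := h.inj P.unop inferInstance
  inj P hP := h.proj P.unop inferInstance
  complete_left M := by
    obtain ⟨B, A, i, p, z, hS, hA, hB⟩ := h.complete_right M.unop
    exact ⟨Opposite.op A, Opposite.op B, p.op, i.op, Quiver.Hom.unop_inj z, hS.op, hB, hA⟩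
  complete_right M := by
    obtain ⟨B, A, i, p, z, hS, hA, hB⟩ := h.complete_left M.unop
    exact ⟨Opposite.op A, Opposite.op B, p.op, i.op, Quiver.Hom.unop_inj z, hS.op, hB, hA⟩

variable [HasExt.{w} C]

open Abelian in
-- Each field is one stretch of a long exact Ext sequence. Heredity beyond Ext¹ enters only in
-- `ker_left` and `coker_right`, through the vanishing of Ext².
lemma IsCompleteHereditaryCotorsionPair.chPair {X Y : ObjectProperty C}
    (h : IsCompleteHereditaryCotorsionPair.{w} X Y) : CHPair X Y where
  lift {S} hS hY {A} hA f := by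
    have := h.hereditary A _ hA hY 1 le_rfl
    obtain ⟨g, hg⟩ := Ext.covariant_sequence_exact₃ A hS (Ext.mk₀ f) (zero_add 1)
      (Subsingleton.elim _ _)
    obtain ⟨g, rfl⟩ := (Ext.mk₀_bijective _ _).2 g
    exact ⟨g, (Ext.mk₀_bijective _ _).1 (by simpa using hg)⟩
  extend {S} hS hX {B} hB f := by
    have := h.hereditary _ B hX hB 1 le_rfl
    obtain ⟨g, hg⟩ := Ext.contravariant_sequence_exact₁ hS B (Ext.mk₀ f) (add_zero 1)
      (Subsingleton.elim _ _)
    obtain ⟨g, rfl⟩ := (Ext.mk₀_bijective _ _).2 g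
    exact ⟨g, (Ext.mk₀_bijective _ _).1 (by simpa using hg)⟩
  iso_left := by rw [h.eq_leftPerp]; exact leftPerp_iso Y
  iso_right := by rw [← h.rightPerp_eq]; exact rightPerp_iso X
  ext_left {S} hS h₁ h₃ := by
    rw [h.eq_leftPerp]
    intro B hB
    refine subsingleton_of_forall_eq 0 (fun x => ?_)
    have := h.hereditary _ B h₁ hB 1 le_rfl
    have := h.hereditary _ B h₃ hB 1 le_rfl
    obtain ⟨y, rfl⟩ := Ext.contravariant_sequence_exact₂ hS B x (Subsingleton.elim _ _)
    rw [Subsingleton.elim y 0, Ext.comp_zero]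
  ext_right {S} hS h₁ h₃ := by
    rw [← h.rightPerp_eq]
    intro A hA
    refine subsingleton_of_forall_eq 0 (fun x => ?_)
    have := h.hereditary A _ hA h₁ 1 le_rfl
    have := h.hereditary A _ hA h₃ 1 le_rfl
    obtain ⟨y, rfl⟩ := Ext.covariant_sequence_exact₂ A hS x (Subsingleton.elim _ _)
    rw [Subsingleton.elim y 0, Ext.zero_comp]
  ker_left {S} hS h₂ h₃ := by
    rw [h.eq_leftPerp]
    intro B hB
    refine subsingleton_of_forall_eq 0 (fun x => ?_)
    have := h.hereditary _ B h₂ hB 1 le_rfl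
    have := h.hereditary _ B h₃ hB 2 one_le_two
    obtain ⟨y, rfl⟩ := Ext.contravariant_sequence_exact₁ hS B x (n₁ := 2) rfl
      (Subsingleton.elim _ _)
    rw [Subsingleton.elim y 0, Ext.comp_zero]
  coker_right {S} hS h₁ h₂ := by
    rw [← h.rightPerp_eq]
    intro A hA
    refine subsingleton_of_forall_eq 0 (fun x => ?_)
    have := h.hereditary A _ hA h₁ 2 one_le_two
    have := h.hereditary A _ hA h₂ 1 le_rfl
    obtain ⟨y, rfl⟩ := Ext.covariant_sequence_exact₃ A hS x (n₁ := 2) rfl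
      (Subsingleton.elim _ _)
    rw [Subsingleton.elim y 0, Ext.zero_comp]
  proj P hP := by
    rw [h.eq_leftPerp]
    intro B _
    exact Ext.subsingleton_of_projective P B 0
  inj I hI := by
    rw [← h.rightPerp_eq]
    intro A _
    exact Ext.subsingleton_of_injective A I 0
  complete_left := h.complete_left
  complete_right := h.complete_right

end CHPair

/-! ### Exactness of coproducts -/

section Sigma

variable {C : Type u} [Category.{v} C]

/-- Embed `∐ A` into an injective and extend each coprojection along `f i`: the embedding then
factors through the map in question. -/
lemma mono_sigmaMap [HasCoproductsOfShape ℕ C] [EnoughInjectives C] {A B : ℕ → C} (f : ∀ i, A i ⟶ B i)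
    [∀ i, Mono (f i)] : Mono (Limits.Sigma.map f) := by
  have : Limits.Sigma.map f ≫ Sigma.desc (fun i => Injective.factorThru
      (Sigma.ι A i ≫ Injective.ι (∐ A)) (f i)) = Injective.ι (∐ A) := by
    ext i
    simp
  exact mono_of_mono_fac this

variable [Abelian C] [HasCoproductsOfShape ℕ C]

/-- The coproduct of a family of short complexes. -/
def sigmaShortComplex (S : ℕ → ShortComplex C) : ShortComplex C :=
  ShortComplex.mk (Limits.Sigma.map fun i => (S i).f) (Limits.Sigma.map fun i => (S i).g) (by
    ext i
    simp)

/-- Coproducts always commute with cokernels, so only the monomorphisms `cokernel (S i).f ⟶ (S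
i).X₃` need care; `mono_sigmaMap` handles them. -/
lemma sigmaShortComplex_exact [EnoughInjectives C] (S : ℕ → ShortComplex C)
    (hS : ∀ i, (S i).Exact) : (sigmaShortComplex S).Exact := by
  let T (i : ℕ) : ShortComplex C :=
    ShortComplex.mk (S i).f (cokernel.π (S i).f) (cokernel.condition _)
  let m (i : ℕ) : cokernel (S i).f ⟶ (S i).X₃ := cokernel.desc _ (S i).g (S i).zero
  have hm (i : ℕ) : Mono (m i) := (S i).exact_iff_mono_cokernel_desc.1 (hS i)
  let φ : sigmaShortComplex T ⟶ sigmaShortComplex S :=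
    { τ₁ := 𝟙 (∐ fun i => (S i).X₁)
      τ₂ := 𝟙 (∐ fun i => (S i).X₂)
      τ₃ := Limits.Sigma.map m
      comm₁₂ := (Category.id_comp _).trans (Category.comp_id _).symm
      comm₂₃ := by
        refine (Category.id_comp _).trans (Sigma.hom_ext _ _ fun i => ?_)
        dsimp only [sigmaShortComplex, T]
        simp [m] }
  have : Epi φ.τ₁ := inferInstanceAs (Epi (𝟙 (∐ fun i => (S i).X₁)))
  have : IsIso φ.τ₂ := inferInstanceAs (IsIso (𝟙 (∐ fun i => (S i).X₂)))
  have : Mono φ.τ₃ := mono_sigmaMap m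
  refine (ShortComplex.exact_iff_of_epi_of_isIso_of_mono φ).1
    (ShortComplex.exact_of_g_is_cokernel _ (CokernelCofork.IsColimit.ofπ
      (f := Limits.Sigma.map fun i => (S i).f) (Limits.Sigma.map fun i => cokernel.π (S i).f)
      (sigmaShortComplex T).zero
      (fun {W} k hk => Sigma.desc (fun i => cokernel.desc _
        (Sigma.ι (fun i => (S i).X₂) i ≫ k) ?_)) ?_ ?_))
  · have := Sigma.ι (fun i => (S i).X₁) i ≫= hk
    simpa using this
  · intro W k hk
    ext i
    simp
  · intro W k hk l hl
    refine Sigma.hom_ext _ _ fun i => ?_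
    refine (cancel_epi (cokernel.π (S i).f)).1 ?_
    rw [Sigma.ι_desc, cokernel.π_desc, ← hl, Sigma.ι_map_assoc]

/-- The termwise coproduct of a sequence of complexes. -/
def sigmaComplex (P : ℕ → CochainComplex C ℤ) : CochainComplex C ℤ where
  X n := ∐ fun i => (P i).X n
  d n m := Limits.Sigma.map fun i => (P i).d n m
  shape n m h := by
    ext i
    simp [(P i).shape n m h]
  d_comp_d' _ _ _ _ _ := by
    ext i
    simp

namespace sigmaComplex

variable (P : ℕ → CochainComplex C ℤ)

/-- The inclusions of the summands in each degree. -/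
def inc (i : ℕ) (n : ℤ) : (P i).X n ⟶ (sigmaComplex P).X n := Sigma.ι (fun i => (P i).X n) i

variable {P} in
lemma hom_ext {n : ℤ} {W : C} {f g : (sigmaComplex P).X n ⟶ W}
    (h : ∀ i, inc P i n ≫ f = inc P i n ≫ g) : f = g :=
  Sigma.hom_ext _ _ h

@[simp]
lemma inc_d (i : ℕ) (n m : ℤ) :
    inc P i n ≫ (sigmaComplex P).d n m = (P i).d n m ≫ inc P i m :=
  Sigma.ι_map (fun i => (P i).d n m) i

@[simp]
lemma inc_d_assoc (i : ℕ) (n m : ℤ) {W : C} (g : (sigmaComplex P).X m ⟶ W) :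
    inc P i n ≫ (sigmaComplex P).d n m ≫ g = (P i).d n m ≫ inc P i m ≫ g :=
  (reassoc_of% inc_d P i n m) g

/-- The morphism from the coproduct in a given degree induced by a family of morphisms. -/
def descX {P : ℕ → CochainComplex C ℤ} {n : ℤ} {W : C} (f : ∀ i, (P i).X n ⟶ W) :
    (sigmaComplex P).X n ⟶ W := Sigma.desc f

variable {P} in
@[simp]
lemma inc_descX {n : ℤ} {W : C} (f : ∀ i, (P i).X n ⟶ W) (i : ℕ) :
    inc P i n ≫ descX f = f i :=
  Sigma.ι_desc f i

variable {P} in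
@[simp]
lemma inc_descX_assoc {n : ℤ} {W W' : C} (f : ∀ i, (P i).X n ⟶ W) (i : ℕ) (g : W ⟶ W') :
    inc P i n ≫ descX f ≫ g = f i ≫ g :=
  (reassoc_of% inc_descX f i) g

/-- The inclusions of the summands. -/
@[simps]
def ι (i : ℕ) : P i ⟶ sigmaComplex P where
  f n := inc P i n

variable {P}

/-- The morphism from the coproduct induced by a family of morphisms. -/
@[simps]
def desc {E : CochainComplex C ℤ} (f : ∀ i, P i ⟶ E) : sigmaComplex P ⟶ E where
  f n := descX fun i => (f i).f n
  comm' n m _ := hom_ext fun i => by simp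

@[simp]
lemma ι_desc {E : CochainComplex C ℤ} (f : ∀ i, P i ⟶ E) (i : ℕ) : ι P i ≫ desc f = f i := by
  ext n
  simp

@[simp]
lemma ι_desc_assoc {E E' : CochainComplex C ℤ} (f : ∀ i, P i ⟶ E) (i : ℕ) (g : E ⟶ E') :
    ι P i ≫ desc f ≫ g = f i ≫ g :=
  (reassoc_of% ι_desc f i) g

lemma complex_hom_ext {E : CochainComplex C ℤ} {f g : sigmaComplex P ⟶ E}
    (h : ∀ i, ι P i ≫ f = ι P i ≫ g) : f = g := by
  ext n : 1
  exact hom_ext fun i => HomologicalComplex.congr_hom (h i) n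

variable (P) in
open CochainComplex in
lemma isKProjective [∀ i, (P i).IsKProjective] : (sigmaComplex P).IsKProjective where
  nonempty_homotopy_zero {L} f hL := by
    let h (i : ℕ) := IsKProjective.homotopyZero (ι P i ≫ f) hL
    refine ⟨{ hom := fun p q => descX fun i => (h i).hom p q, zero := ?_, comm := ?_ }⟩
    · intro p q hpq
      exact hom_ext fun i => by simp [(h i).zero p q hpq]
    · intro n
      refine hom_ext fun i => ?_
      have := (h i).comm n
      rw [dNext_eq _ (i' := n + 1) (by simp), prevD_eq _ (j' := n - 1) (by simp)] at this ⊢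
      simpa using this

lemma projective [∀ i, ∀ n, Projective ((P i).X n)] (n : ℤ) :
    Projective ((sigmaComplex P).X n) :=
  ⟨fun f e _ => ⟨descX fun i => Projective.factorThru (inc P i n ≫ f) e,
    hom_ext fun i => by simp⟩⟩

/-- If `Q i ⟶ A i ⟶ B i` are exact, with `A i` and `B i` the terms of complexes in two degrees,
then the coproduct is exact. -/
lemma exists_lift [EnoughInjectives C] {n m : ℤ} (Q : ℕ → C) (z : ∀ i, Q i ⟶ (P i).X n)
    (hz : ∀ i, z i ≫ (P i).d n m = 0) (hz' : ∀ i, (ShortComplex.mk _ _ (hz i)).Exact)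
    {T : C} (x : T ⟶ (sigmaComplex P).X n) (hx : x ≫ (sigmaComplex P).d n m = 0) :
    ∃ (T' : C) (π : T' ⟶ T) (_ : Epi π) (θ : T' ⟶ ∐ Q),
      π ≫ x = θ ≫ Sigma.desc (fun i => z i ≫ inc P i n) := by
  obtain ⟨T', π, hπ, θ, h⟩ := (sigmaShortComplex_exact _ hz').exact_up_to_refinements x hx
  refine ⟨T', π, hπ, θ, h.trans ?_⟩
  congr 1

end sigmaComplex

end Sigma

/-! ### Existence of K-projective resolutions -/

section KProjectiveResolution

open CochainComplex CochainComplex.HomComplex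

variable {C : Type u} [Category.{v} C] [Abelian C]

section

variable [EnoughProjectives C] (Z : ℤ → C)

/-- The complex with zero differentials consisting of projective covers of a graded object. -/
def zeroCover : CochainComplex C ℤ where
  X n := Projective.over (Z n)
  d _ _ := 0

@[simp]
lemma zeroCover_d (i j : ℤ) : (zeroCover Z).d i j = 0 := rfl

/-- The covering morphisms. -/
def zeroCoverπ (n : ℤ) : (zeroCover Z).X n ⟶ Z n := Projective.π _

instance (n : ℤ) : Epi (zeroCoverπ Z n) := inferInstanceAs (Epi (Projective.π _))

instance (n : ℤ) : Projective ((zeroCover Z).X n) :=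
  inferInstanceAs (Projective (Projective.over _))

end

lemma exact_epi_comp_iCycles (K : CochainComplex C ℤ) (n m : ℤ) (hnm : n + 1 = m) {W : C}
    (p : W ⟶ K.cycles n) [Epi p] :
    (ShortComplex.mk (p ≫ K.iCycles n) (K.d n m) (by simp)).Exact := by
  let T := ShortComplex.mk (K.iCycles n) (K.d n m) (by simp)
  have hT : T.Exact := ShortComplex.exact_of_f_is_kernel _ (K.cyclesIsKernel n m (by simp [hnm]))
  let φ : ShortComplex.mk (p ≫ K.iCycles n) (K.d n m) (by simp) ⟶ T :=
    { τ₁ := p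
      τ₂ := 𝟙 (K.X n)
      τ₃ := 𝟙 (K.X m)
      comm₁₂ := (Category.comp_id _).symm }
  have : Epi φ.τ₁ := inferInstanceAs (Epi p)
  have : IsIso φ.τ₂ := inferInstanceAs (IsIso (𝟙 _))
  have : Mono φ.τ₃ := inferInstanceAs (Mono (𝟙 _))
  exact (ShortComplex.exact_iff_of_epi_of_isIso_of_mono φ).2 hT

/-- The morphism from a complex with zero differentials given by a family of cocycles. -/
@[simps]
def zeroDiffDesc {Q K : CochainComplex C ℤ} (hQ : ∀ i j, Q.d i j = 0) (f : ∀ n, Q.X n ⟶ K.X n)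
    (hf : ∀ n m, f n ≫ K.d n m = 0) : Q ⟶ K where
  f := f
  comm' n m _ := by simp [hf, hQ]

lemma acyclic_exists_lift {K : CochainComplex C ℤ} (hK : K.Acyclic) {P : C} [Projective P]
    (i j k : ℤ) (hij : i + 1 = j) (hjk : j + 1 = k) (x : P ⟶ K.X j) (hx : x ≫ K.d j k = 0) :
    ∃ y : P ⟶ K.X i, y ≫ K.d i j = x := by
  have h := (K.exactAt_iff' i j k (by simp [← hij]) (by simp [hjk])).1 (hK j)
  exact ⟨h.liftFromProjective x hx, h.liftFromProjective_comp x hx⟩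

/-- Each component of a morphism to an acyclic complex takes values in cycles, hence lifts through
the differential by projectivity; as the source has no differential, these lifts already form a
null-homotopy. -/
lemma isKProjective_of_d_eq_zero {Q : CochainComplex C ℤ} (hQ : ∀ i j, Q.d i j = 0)
    [∀ n, Projective (Q.X n)] : Q.IsKProjective where
  nonempty_homotopy_zero {L} f hL := by
    have hf (n : ℤ) : ∃ y : Q.X n ⟶ L.X (n - 1), y ≫ L.d (n - 1) n = f.f n :=
      acyclic_exists_lift hL _ n (n + 1) (by lia) rfl (f.f n) (by rw [f.comm]; simp [hQ])
    choose y hy using hf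
    refine ⟨{ hom := fun p r => if h : r + 1 = p then
                y p ≫ (L.XIsoOfEq (by lia)).hom else 0
              zero := fun p r hpr => dif_neg hpr
              comm := fun n => ?_ }⟩
    rw [dNext_eq _ (i' := n + 1) (by simp), prevD_eq _ (j' := n - 1) (by simp)]
    simp [hy, hQ]

lemma isKProjective_mappingCone {K L : CochainComplex C ℤ} (f : K ⟶ L) [K.IsKProjective]
    [L.IsKProjective] : (mappingCone f).IsKProjective := by
  rw [isKProjective_iff_leftOrthogonal]
  exact ObjectProperty.ext_of_isTriangulatedClosed₃ _ _
    (HomotopyCategory.mappingCone_triangleh_distinguished f)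
    (IsKProjective.leftOrthogonal K) (IsKProjective.leftOrthogonal L)

lemma projective_mappingCone {K L : CochainComplex C ℤ} (f : K ⟶ L)
    [∀ n, Projective (K.X n)] [∀ n, Projective (L.X n)] (n : ℤ) :
    Projective ((mappingCone f).X n) :=
  Projective.of_iso (HomologicalComplex.homotopyCofiber.XIsoBiprod f n (n + 1) rfl).symm
    inferInstance

variable [EnoughProjectives C]

/-- Partial K-projective resolutions of a complex `M`, which are surjective on homology. -/
structure PartialRes (M : CochainComplex C ℤ) where
  P : CochainComplex C ℤ
  f : P ⟶ M
  [kProj : P.IsKProjective]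
  [proj : ∀ n, Projective (P.X n)]
  ρ (n : ℤ) : (zeroCover (fun n => M.cycles n)).X n ⟶ P.X n
  hρ (n m : ℤ) : ρ n ≫ P.d n m = 0
  hρf (n : ℤ) : ρ n ≫ f.f n = zeroCoverπ _ n ≫ M.iCycles n

namespace PartialRes

attribute [instance] kProj proj

variable {M : CochainComplex C ℤ}

variable (M) in
/-- The first step of the resolution. -/
def init : PartialRes M where
  P := zeroCover (fun n => M.cycles n)
  f := zeroDiffDesc (by simp) (fun n => zeroCoverπ _ n ≫ M.iCycles n) (by simp)
  kProj := isKProjective_of_d_eq_zero (by simp)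
  ρ n := 𝟙 _
  hρ := by simp
  hρf n := Category.id_comp _

variable (S : PartialRes M)

/-- Projective objects covering the cycles of the mapping cone. -/
def Q : CochainComplex C ℤ := zeroCover (fun n => (mappingCone S.f).cycles (n - 1))

lemma Q_d (i j : ℤ) : S.Q.d i j = 0 := rfl

instance (n : ℤ) : Projective (S.Q.X n) :=
  inferInstanceAs (Projective ((zeroCover _).X n))

/-- The projective covers of the cycles of the mapping cone. -/
def π (n : ℤ) : S.Q.X n ⟶ (mappingCone S.f).cycles (n - 1) := zeroCoverπ _ n

instance (n : ℤ) : Epi (S.π n) := inferInstanceAs (Epi (zeroCoverπ _ n))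

/-- The projective covers of the cycles of the mapping cone. -/
def z (n : ℤ) : S.Q.X n ⟶ (mappingCone S.f).X (n - 1) :=
  S.π n ≫ (mappingCone S.f).iCycles (n - 1)

lemma z_d (n : ℤ) : S.z n ≫ (mappingCone S.f).d (n - 1) n = 0 := by
  simp [z]

lemma z_exact (n : ℤ) : (ShortComplex.mk _ _ (S.z_d n)).Exact :=
  exact_epi_comp_iCycles _ _ _ (by lia) (S.π n)

/-- The components in `P` of the cocycles. -/
def φX (n : ℤ) : S.Q.X n ⟶ S.P.X n := S.z n ≫ (mappingCone.fst S.f).1.v (n - 1) n (by lia)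

/-- The components in `M` of the cocycles. -/
def αX (n : ℤ) : S.Q.X n ⟶ M.X (n - 1) :=
  S.z n ≫ (mappingCone.snd S.f).v (n - 1) (n - 1) (by lia)

lemma φX_d (n m : ℤ) : S.φX n ≫ S.P.d n m = 0 := by
  by_cases h : n + 1 = m
  · have := (reassoc_of% S.z_d n) ((mappingCone.fst S.f).1.v n m h)
    rw [mappingCone.d_fst_v S.f (n - 1) n m (by lia) h, zero_comp, Preadditive.comp_neg,
      neg_eq_zero] at this
    simpa [φX] using this
  · rw [S.P.shape n m h, comp_zero]

/-- A cocycle of the cone is a pair (x, y) with dx = 0 and f(x) + dy = 0. Hence `φX` covers exactly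
the cocycles of `P` whose image in `M` is a boundary, the ones to be killed in the next step. -/
lemma φX_f (n : ℤ) : S.φX n ≫ S.f.f n = - S.αX n ≫ M.d (n - 1) n := by
  have := (reassoc_of% S.z_d n) ((mappingCone.snd S.f).v n n (by lia))
  rw [mappingCone.d_snd_v S.f (n - 1) n (by lia), zero_comp, Preadditive.comp_add,
    ← Category.assoc, ← Category.assoc] at this
  exact eq_neg_of_add_eq_zero_left this

/-- The attaching map. -/
def φ : S.Q ⟶ S.P := zeroDiffDesc S.Q_d S.φX S.φX_d

/-- The homotopy used in order to extend the morphism to `M`. -/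
def α : Cochain (S.Q) M (-1) :=
  Cochain.mk (fun p q _ => -S.αX p ≫ (M.XIsoOfEq (by lia)).hom)

lemma δ_α : δ (-1) 0 S.α = Cochain.ofHom (S.φ ≫ S.f) := by
  ext n
  rw [δ_v (-1) 0 rfl _ n n (by lia) (n - 1) (n + 1) rfl rfl, Q_d]
  simp [α, φ, φX_f]

/-- The next step of the resolution. -/
def next : PartialRes M where
  P := mappingCone S.φ
  f := mappingCone.desc S.φ S.α S.f S.δ_α
  kProj := by
    have := isKProjective_of_d_eq_zero S.Q_d
    exact isKProjective_mappingCone S.φ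
  proj n := projective_mappingCone S.φ n
  ρ n := S.ρ n ≫ (mappingCone.inr S.φ).f n
  hρ n m := by
    rw [Category.assoc, (mappingCone.inr S.φ).comm, reassoc_of% S.hρ, zero_comp]
  hρf n := by
    rw [Category.assoc, mappingCone.inr_f_desc_f, S.hρf]

/-- The transition morphism. -/
def toNext : S.P ⟶ S.next.P := mappingCone.inr S.φ

lemma toNext_f : S.toNext ≫ S.next.f = S.f :=
  mappingCone.inr_desc _ _ _ S.δ_α

/-- The attaching map is a boundary in the next step. -/
def bd (n : ℤ) : S.Q.X n ⟶ S.next.P.X (n - 1) := (mappingCone.inl S.φ).v n (n - 1) (by lia)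

lemma bd_d (n : ℤ) : S.bd n ≫ S.next.P.d (n - 1) n = S.φX n ≫ S.toNext.f n := by
  refine (mappingCone.inl_v_d S.φ n (n - 1) (n + 1) (by lia) (by lia)).trans ?_
  rw [Q_d, zero_comp, sub_zero]
  rfl

end PartialRes

end KProjectiveResolution

/-! ### The mapping telescope -/

section Telescope

variable {C : Type u} [Category.{v} C] [Abelian C]

/-- If x(1 - s) = 0 then xF(1 - t) = 0, so xF = 0 by the retraction `r`; then xs = 0, and x = xs =
0. -/
lemma telescope_mono {N L : C} {F : N ⟶ L} {s : N ⟶ N} {t : L ⟶ L} {r : L ⟶ L}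
    (hst : s ≫ F = F ≫ t) (hr : (𝟙 L - t) ≫ r = 𝟙 L)
    (hs : ∀ ⦃T : C⦄ (x : T ⟶ N), x ≫ F = 0 → x ≫ s = 0) : Mono (𝟙 N - s) := by
  refine Preadditive.mono_of_cancel_zero _ fun {T} x hx => ?_
  have h₁ : (𝟙 N - s) ≫ F = F ≫ (𝟙 L - t) := by simp [hst]
  have h₂ : x ≫ F = 0 := by
    rw [← Category.comp_id F, ← hr, ← reassoc_of% h₁, reassoc_of% hx, zero_comp]
  simpa [hs x h₂] using hx

/-- Solve the equation first after applying `F`, where the splitting `r` does it, and lift the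
solution through the epimorphism `F`. The error w satisfies wF = 0, hence ws = 0, so w = w(1 - s)
lies in the image as well. -/
lemma telescope_exact {N L M : C} {F : N ⟶ L} [Epi F] {s : N ⟶ N} {t : L ⟶ L} {r : L ⟶ L}
    {p : L ⟶ M} {c : M ⟶ L} (hst : s ≫ F = F ≫ t) (hpc : p ≫ c + r ≫ (𝟙 L - t) = 𝟙 L)
    (hs : ∀ ⦃T : C⦄ (x : T ⟶ N), x ≫ F = 0 → x ≫ s = 0) {T : C} (x : T ⟶ N)
    (hx : x ≫ F ≫ p = 0) :
    ∃ (T' : C) (π : T' ⟶ T) (_ : Epi π) (y : T' ⟶ N), π ≫ x = y ≫ (𝟙 N - s) := by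
  have h₁ : (𝟙 N - s) ≫ F = F ≫ (𝟙 L - t) := by simp [hst]
  have h₂ : x ≫ F = (x ≫ F ≫ r) ≫ (𝟙 L - t) := by
    conv_lhs => rw [← Category.comp_id F, ← hpc]
    simp [reassoc_of% hx]
  obtain ⟨T', π, hπ, y, hy⟩ := surjective_up_to_refinements_of_epi F (x ≫ F ≫ r)
  have h₃ : (π ≫ x - y ≫ (𝟙 N - s)) ≫ F = 0 := by
    rw [Preadditive.sub_comp, Category.assoc, Category.assoc, h₁, h₂, ← Category.assoc π, hy,
      Category.assoc, sub_self]
  have h₄ := hs _ h₃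
  refine ⟨T', π, hπ, y + (π ≫ x - y ≫ (𝟙 N - s)), ?_⟩
  rw [Preadditive.add_comp, Preadditive.comp_sub (π ≫ x - y ≫ (𝟙 N - s)), h₄, Category.comp_id]
  abel

open CochainComplex HomologicalComplex in
-- Injectivity of `f` on homology kills the connecting maps of the long exact sequence, so the
-- homology of the cone is the cokernel of that of `f`. The last two hypotheses say that `g`
-- identifies this cokernel with the homology of `M`.
lemma quasiIso_mappingCone_desc {K L M : CochainComplex C ℤ} (f : K ⟶ L) (g : L ⟶ M)
    (G : mappingCone f ⟶ M) (hG : mappingCone.inr f ≫ G = g)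
    (hf : ∀ n, Mono (homologyMap f n)) (hg : ∀ n, Epi (homologyMap g n))
    (hex : ∀ (n : ℤ) ⦃T : C⦄ (x : T ⟶ L.homology n), x ≫ homologyMap g n = 0 →
      ∃ (T' : C) (π : T' ⟶ T) (_ : Epi π) (y : T' ⟶ K.homology n),
        π ≫ x = y ≫ homologyMap f n) : QuasiIso G := by
  rw [quasiIso_iff]
  intro n
  rw [quasiIsoAt_iff_isIso_homologyMap]
  let H := HomotopyCategory.homologyFunctor C (ComplexShape.up ℤ) 0
  let e (n : ℤ) := HomotopyCategory.homologyFunctorFactors C (ComplexShape.up ℤ) n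
  have hT := HomotopyCategory.mappingCone_triangleh_distinguished f
  have hm (n : ℤ) : Mono ((H.shift n).map (mappingCone.triangleh f).mor₁) := by
    have := hf n
    exact ((MorphismProperty.monomorphisms C).arrow_mk_iso_iff
      (((Functor.mapArrowFunctor _ _).mapIso (e n)).app (Arrow.mk f))).2 this
  have hi : Epi (homologyMap (mappingCone.inr f) n) := by
    have : Epi ((H.shift n).map (mappingCone.triangleh f).mor₂) := by
      rw [H.homologySequence_epi_shift_map_mor₂_iff _ hT n (n + 1) rfl,
        ← H.homologySequence_mono_shift_map_mor₁_iff _ hT n (n + 1) rfl]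
      exact hm (n + 1)
    exact ((MorphismProperty.epimorphisms C).arrow_mk_iso_iff
      (((Functor.mapArrowFunctor _ _).mapIso (e n)).app (Arrow.mk (mappingCone.inr f)))).1 this
  have hfi : homologyMap f n ≫ homologyMap (mappingCone.inr f) n = 0 := by
    rw [← homologyMap_comp]
    exact ((homotopyCofiber.inrCompHomotopy f (fun j => ⟨j - 1, by simp⟩)).homologyMap_eq n).trans
      (homologyMap_zero _ _ _)
  have hiG : homologyMap (mappingCone.inr f) n ≫ homologyMap G n = homologyMap g n := by
    rw [← homologyMap_comp, hG]
  have : Epi (homologyMap G n) := by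
    have := hg n
    exact epi_of_epi_fac hiG
  have : Mono (homologyMap G n) := by
    refine Preadditive.mono_of_cancel_zero _ fun {T} x hx => ?_
    obtain ⟨T', π, hπ, y, hy⟩ :=
      surjective_up_to_refinements_of_epi (homologyMap (mappingCone.inr f) n) x
    obtain ⟨T'', π', hπ', w, hw⟩ := hex n y (by rw [← hiG, ← reassoc_of% hy, hx, comp_zero])
    rw [← cancel_epi π, ← cancel_epi π', hy, reassoc_of% hw, hfi]
    simp
  exact isIso_of_mono_of_epi _

end Telescope

/-! ### The telescope of the partial resolutions is a K-projective resolution. -/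

section KProjectiveResolution

open CochainComplex CochainComplex.HomComplex HomologicalComplex

variable {C : Type u} [Category.{v} C] [Abelian C] [HasCoproductsOfShape ℕ C]

namespace PartialRes

variable (M : CochainComplex C ℤ)

/-- The coproduct of countably many copies of a complex. -/
abbrev copies : CochainComplex C ℤ := sigmaComplex fun _ : ℕ => M

/-- The shift of the summands of the copower. -/
def copiesTrans : copies M ⟶ copies M :=
  sigmaComplex.desc fun i => sigmaComplex.ι (fun _ => M) (i + 1)

/-- The codiagonal. -/
def fold : copies M ⟶ M := sigmaComplex.desc fun _ => 𝟙 M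

/-- The retraction in the telescope of the copower. -/
def copiesRetr : copies M ⟶ copies M :=
  sigmaComplex.desc fun i => -∑ j ∈ Finset.range i, sigmaComplex.ι (fun _ => M) j

lemma copies_retr : (𝟙 _ - copiesTrans M) ≫ copiesRetr M = 𝟙 _ := by
  refine sigmaComplex.complex_hom_ext fun i => ?_
  rw [Preadditive.sub_comp, Preadditive.comp_sub, Category.id_comp, copiesTrans, copiesRetr,
    sigmaComplex.ι_desc_assoc, sigmaComplex.ι_desc, sigmaComplex.ι_desc, Finset.sum_range_succ,
    Category.comp_id]
  abel

/-- With `copies_retr`, this splits the telescope sequence of the constant system M. A splitting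
survives any additive functor, so homology need not be compared with coproducts. -/
lemma fold_splitting : fold M ≫ (sigmaComplex.ι (fun _ => M) 0 : M ⟶ copies M) +
    copiesRetr M ≫ (𝟙 _ - copiesTrans M) = 𝟙 _ := by
  have h (j : ℕ) : sigmaComplex.ι (fun _ => M) j ≫ copiesTrans M =
      sigmaComplex.ι (fun _ => M) (j + 1) := by
    rw [copiesTrans, sigmaComplex.ι_desc]
  refine sigmaComplex.complex_hom_ext fun i => ?_
  rw [Preadditive.comp_add, Preadditive.comp_sub, Category.comp_id, Preadditive.comp_sub, fold,
    copiesRetr, sigmaComplex.ι_desc_assoc, sigmaComplex.ι_desc_assoc, sigmaComplex.ι_desc,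
    Preadditive.neg_comp, Preadditive.sum_comp, Finset.sum_congr rfl fun j _ => h j,
    Category.id_comp, Category.comp_id, ← sub_eq_zero]
  have := Finset.sum_range_succ' (fun j => sigmaComplex.ι (fun _ => M) j) i
  rw [Finset.sum_range_succ] at this
  rw [eq_sub_of_add_eq' this]
  abel

variable [EnoughProjectives C]

/-- The sequence of partial resolutions. -/
def seq : ℕ → PartialRes M
  | 0 => init M
  | i + 1 => (seq i).next

/-- The transition morphisms. -/
def seqTrans (i : ℕ) : (seq M i).P ⟶ (seq M (i + 1)).P := (seq M i).toNext

omit [HasCoproductsOfShape ℕ C] in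
lemma seqTrans_f (i : ℕ) : seqTrans M i ≫ (seq M (i + 1)).f = (seq M i).f := toNext_f (seq M i)

/-- The attaching cochains. -/
def seqBd (i : ℕ) (n : ℤ) : (seq M i).Q.X n ⟶ (seq M (i + 1)).P.X (n - 1) := (seq M i).bd n

omit [HasCoproductsOfShape ℕ C] in
lemma seqBd_d (i : ℕ) (n : ℤ) : seqBd M i n ≫ (seq M (i + 1)).P.d (n - 1) n =
    (seq M i).φX n ≫ (seqTrans M i).f n :=
  (seq M i).bd_d n

/-- The coproduct of the partial resolutions. -/
abbrev tot : CochainComplex C ℤ := sigmaComplex fun i => (seq M i).P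

/-- The transition morphisms on the coproduct. -/
def trans : tot M ⟶ tot M :=
  sigmaComplex.desc fun i => seqTrans M i ≫ sigmaComplex.ι (fun i => (seq M i).P) (i + 1)

/-- The augmentations. -/
def aug : tot M ⟶ copies M :=
  sigmaComplex.desc fun i => (seq M i).f ≫ sigmaComplex.ι (fun _ => M) i

lemma inc_trans (i : ℕ) (n : ℤ) :
    sigmaComplex.inc (fun i => (seq M i).P) i n ≫ (trans M).f n =
      (seqTrans M i).f n ≫ sigmaComplex.inc (fun i => (seq M i).P) (i + 1) n :=
  sigmaComplex.inc_descX _ i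

lemma inc_aug (i : ℕ) (n : ℤ) :
    sigmaComplex.inc (fun i => (seq M i).P) i n ≫ (aug M).f n =
      (seq M i).f.f n ≫ sigmaComplex.inc (fun _ => M) i n :=
  sigmaComplex.inc_descX _ i

lemma trans_aug : trans M ≫ aug M = aug M ≫ copiesTrans M := by
  ext n : 1
  refine sigmaComplex.hom_ext fun i => ?_
  have h₁ : (seqTrans M i).f n ≫ (seq M (i + 1)).f.f n = (seq M i).f.f n :=
    HomologicalComplex.congr_hom (seqTrans_f M i) n
  have h₂ : sigmaComplex.inc (fun _ => M) i n ≫ (copiesTrans M).f n =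
    sigmaComplex.inc (fun _ => M) (i + 1) n := sigmaComplex.inc_descX _ i
  rw [comp_f, comp_f, reassoc_of% inc_trans, reassoc_of% inc_aug, h₂, ← h₁, Category.assoc, inc_aug]

variable [EnoughInjectives C]

/-- The lifts `ρ` have the same source at every stage and are carried along as data. Lifts up to
refinement, found separately for each summand, would need infinitely many refinements of `T` at
once. -/
lemma epi_homologyMap_aug (n : ℤ) : Epi (homologyMap (aug M) n) := by
  rw [epi_homologyMap_iff_up_to_refinements _ (n - 1) n (n + 1) (by simp) (by simp)]
  intro T y hy
  obtain ⟨T', π, hπ, θ, h⟩ := sigmaComplex.exists_lift (P := fun _ => M)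
    (fun _ => (zeroCover (fun n => M.cycles n)).X n) (fun _ => zeroCoverπ _ n ≫ M.iCycles n)
    (m := n + 1) (by simp) (fun _ => exact_epi_comp_iCycles M n _ rfl _) y hy
  have hd : Sigma.desc (fun i => (seq M i).ρ n ≫
      sigmaComplex.inc (fun i => (seq M i).P) i n) ≫ (tot M).d n (n + 1) = 0 :=
    Sigma.hom_ext _ _ fun i => by
      rw [Sigma.ι_desc_assoc, Category.assoc, sigmaComplex.inc_d, reassoc_of% (seq M i).hρ,
        zero_comp, comp_zero]
  have ha (i : ℕ) : ((seq M i).ρ n ≫ sigmaComplex.inc (fun i => (seq M i).P) i n) ≫ (aug M).f n =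
      (zeroCoverπ (fun n => M.cycles n) n ≫ M.iCycles n) ≫ sigmaComplex.inc (fun _ => M) i n := by
    rw [Category.assoc, inc_aug, reassoc_of% (seq M i).hρf, Category.assoc]
  refine ⟨T', π, hπ, θ ≫ Sigma.desc (fun i => (seq M i).ρ n ≫
    sigmaComplex.inc (fun i => (seq M i).P) i n), by rw [Category.assoc, hd, comp_zero], 0, ?_⟩
  rw [h, zero_comp, add_zero, Category.assoc]
  congr 1
  refine Sigma.hom_ext _ _ fun i => ?_
  rw [Sigma.ι_desc, Sigma.ι_desc_assoc]
  exact (ha i).symm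

/-- The pair (x, -y) is a cocycle of the coproduct of the cones, where `z_exact` holds summand by
summand and hence for the coproduct. In the proof `a` and `b` include the two coordinates, and `c`
projects onto the first. -/
lemma exists_lift_φX (n : ℤ) {T : C} (x : T ⟶ (tot M).X n) (hx : x ≫ (tot M).d n (n + 1) = 0)
    (y : T ⟶ (copies M).X (n - 1)) (hxy : x ≫ (aug M).f n = y ≫ (copies M).d (n - 1) n) :
    ∃ (T' : C) (π : T' ⟶ T) (_ : Epi π) (θ : T' ⟶ ∐ fun i => (seq M i).Q.X n),
      π ≫ x = θ ≫ Sigma.desc (fun i => (seq M i).φX n ≫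
        sigmaComplex.inc (fun i => (seq M i).P) i n) := by
  let K (i : ℕ) := mappingCone (seq M i).f
  let a : (tot M).X n ⟶ (sigmaComplex K).X (n - 1) := sigmaComplex.descX fun i =>
    (mappingCone.inl (seq M i).f).v n (n - 1) (by lia) ≫ sigmaComplex.inc K i (n - 1)
  let b (m : ℤ) : (copies M).X m ⟶ (sigmaComplex K).X m := sigmaComplex.descX fun i =>
    (mappingCone.inr (seq M i).f).f m ≫ sigmaComplex.inc K i m
  let a' : (tot M).X (n + 1) ⟶ (sigmaComplex K).X n := sigmaComplex.descX fun i =>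
    (mappingCone.inl (seq M i).f).v (n + 1) n (by lia) ≫ sigmaComplex.inc K i n
  have ha : a ≫ (sigmaComplex K).d (n - 1) n =
      (aug M).f n ≫ b n - (tot M).d n (n + 1) ≫ a' := by
    refine sigmaComplex.hom_ext fun i => ?_
    rw [Preadditive.comp_sub, reassoc_of% inc_aug, sigmaComplex.inc_d_assoc,
      sigmaComplex.inc_descX_assoc, sigmaComplex.inc_descX, sigmaComplex.inc_descX,
      Category.assoc, sigmaComplex.inc_d,
      reassoc_of% mappingCone.inl_v_d (seq M i).f n (n - 1) (n + 1) (by lia) (by lia)]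
    simp
  have hb : b (n - 1) ≫ (sigmaComplex K).d (n - 1) n = (copies M).d (n - 1) n ≫ b n := by
    refine sigmaComplex.hom_ext fun i => ?_
    rw [sigmaComplex.inc_d_assoc, sigmaComplex.inc_descX_assoc, sigmaComplex.inc_descX,
      Category.assoc, sigmaComplex.inc_d, (mappingCone.inr (seq M i).f).comm_assoc]
  let c : (sigmaComplex K).X (n - 1) ⟶ (tot M).X n := sigmaComplex.descX fun i =>
    (mappingCone.fst (seq M i).f).1.v (n - 1) n (by lia) ≫
      sigmaComplex.inc (fun i => (seq M i).P) i n
  have hac : a ≫ c = 𝟙 _ := by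
    refine sigmaComplex.hom_ext fun i => ?_
    rw [sigmaComplex.inc_descX_assoc, Category.assoc, sigmaComplex.inc_descX,
      mappingCone.inl_v_fst_v_assoc, Category.comp_id]
  have hbc : b (n - 1) ≫ c = 0 := by
    refine sigmaComplex.hom_ext fun i => ?_
    rw [sigmaComplex.inc_descX_assoc, Category.assoc, sigmaComplex.inc_descX,
      mappingCone.inr_f_fst_v_assoc, zero_comp, comp_zero]
  obtain ⟨T', π, hπ, θ, h⟩ := sigmaComplex.exists_lift (P := K) (m := n)
    (fun i => (seq M i).Q.X n) (fun i => (seq M i).z n) (fun i => (seq M i).z_d n)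
    (fun i => (seq M i).z_exact n) (x ≫ a - y ≫ b (n - 1)) (by
      rw [Preadditive.sub_comp, Category.assoc, Category.assoc, ha, hb, Preadditive.comp_sub,
        reassoc_of% hxy, reassoc_of% hx]
      simp)
  refine ⟨T', π, hπ, θ, ?_⟩
  have h₁ : x = (x ≫ a - y ≫ b (n - 1)) ≫ c := by
    rw [Preadditive.sub_comp, Category.assoc, Category.assoc, hac, hbc]
    simp
  rw [h₁, reassoc_of% h]
  congr 1
  refine Sigma.hom_ext _ _ fun i => ?_
  rw [Sigma.ι_desc_assoc, Sigma.ι_desc, Category.assoc, sigmaComplex.inc_descX]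
  exact (Category.assoc _ _ _).symm

/-- A class killed by the augmentation is represented, up to refinement, by cocycles coming from the
attaching maps `φX`; each stage makes these boundaries in the following one. -/
lemma homologyMap_trans_of_aug (n : ℤ) {T : C} (x : T ⟶ (tot M).homology n)
    (hx : x ≫ homologyMap (aug M) n = 0) : x ≫ homologyMap (trans M) n = 0 := by
  obtain ⟨T₁, π₁, hπ₁, z, hz, hxz⟩ :=
    (tot M).eq_liftCycles_homologyπ_up_to_refinements x (n + 1) (by simp)
  have h₁ : (copies M).liftCycles (z ≫ (aug M).f n) (n + 1) (by simp)
      (by rw [Category.assoc, (aug M).comm, reassoc_of% hz, zero_comp]) ≫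
        (copies M).homologyπ n = 0 := by
    have := congrArg (π₁ ≫ ·) hx
    rw [reassoc_of% hxz, homologyπ_naturality, comp_zero, liftCycles_comp_cyclesMap_assoc] at this
    exact this
  rw [liftCycles_comp_homologyπ_eq_zero_iff_up_to_refinements _ (n - 1) n (n + 1) (by simp)
    (by simp)] at h₁
  obtain ⟨T₂, π₂, hπ₂, y, hy⟩ := h₁
  obtain ⟨T₃, π₃, hπ₃, θ, hθ⟩ := exists_lift_φX M n (π₂ ≫ z) (by simp [hz]) y (by simpa using hy)
  have hd : Sigma.desc (fun i => (seq M i).φX n ≫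
      sigmaComplex.inc (fun i => (seq M i).P) i n) ≫ (trans M).f n =
      Sigma.desc (fun i => seqBd M i n ≫
        sigmaComplex.inc (fun i => (seq M i).P) (i + 1) (n - 1)) ≫ (tot M).d (n - 1) n := by
    refine Sigma.hom_ext _ _ fun i => ?_
    rw [Sigma.ι_desc_assoc, Sigma.ι_desc_assoc, Category.assoc, inc_trans, Category.assoc,
      sigmaComplex.inc_d, reassoc_of% seqBd_d]
  rw [← cancel_epi π₁, comp_zero, reassoc_of% hxz, homologyπ_naturality,
    liftCycles_comp_cyclesMap_assoc,
    liftCycles_comp_homologyπ_eq_zero_iff_up_to_refinements _ (n - 1) n (n + 1) (by simp)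
    (by simp)]
  refine ⟨T₃, π₃ ≫ π₂, epi_comp _ _, θ ≫ Sigma.desc (fun i => seqBd M i n ≫
        sigmaComplex.inc (fun i => (seq M i).P) (i + 1) (n - 1)), ?_⟩
  rw [Category.assoc, Category.assoc, ← hd, ← Category.assoc π₂, ← Category.assoc π₃, hθ,
    Category.assoc]

lemma exists_quasiIso (M : CochainComplex C ℤ) :
    ∃ (P : CochainComplex C ℤ) (f : P ⟶ M), P.IsKProjective ∧ (∀ n, Projective (P.X n)) ∧
      QuasiIso f := by
  have hK := sigmaComplex.isKProjective fun i => (seq M i).P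
  have hP := sigmaComplex.projective (P := fun i => (seq M i).P)
  have h₀ : (𝟙 _ - trans M) ≫ aug M ≫ fold M = 0 := by
    have : copiesTrans M ≫ fold M = fold M := by
      refine sigmaComplex.complex_hom_ext fun i => ?_
      rw [copiesTrans, sigmaComplex.ι_desc_assoc, fold, sigmaComplex.ι_desc, sigmaComplex.ι_desc]
    rw [Preadditive.sub_comp, ← Category.assoc (trans M), trans_aug, Category.assoc, this,
      Category.id_comp, sub_self]
  have hst (n : ℤ) : homologyMap (trans M) n ≫ homologyMap (aug M) n =
      homologyMap (aug M) n ≫ homologyMap (copiesTrans M) n := by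
    rw [← homologyMap_comp, trans_aug, homologyMap_comp]
  have hσ (n : ℤ) : homologyMap (𝟙 _ - trans M) n = 𝟙 _ - homologyMap (trans M) n := by
    rw [homologyMap_sub, homologyMap_id]
  have hfold (n : ℤ) : homologyMap (fold M) n ≫
      homologyMap (sigmaComplex.ι (fun _ => M) 0 : M ⟶ copies M) n +
      homologyMap (copiesRetr M) n ≫ (𝟙 _ - homologyMap (copiesTrans M) n) = 𝟙 _ := by
    rw [← homologyMap_id, ← homologyMap_sub, ← homologyMap_comp, ← homologyMap_comp,
      ← homologyMap_add, fold_splitting, homologyMap_id]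
  -- The zero cochain suffices to descend to the cone, because (1 - `trans`) composed with `aug M ≫
  -- fold M` vanishes strictly and not only up to homotopy.
  refine ⟨mappingCone (𝟙 _ - trans M), mappingCone.desc _ 0 (aug M ≫ fold M) (by simp [h₀]),
    isKProjective_mappingCone _, projective_mappingCone _,
    quasiIso_mappingCone_desc _ (aug M ≫ fold M) _ (mappingCone.inr_desc _ _ _ _) ?_ ?_ ?_⟩
  · intro n
    rw [hσ]
    refine telescope_mono (hst n) (r := homologyMap (copiesRetr M) n) ?_
      (fun T x hx => homologyMap_trans_of_aug M n x hx)
    rw [← homologyMap_id, ← homologyMap_sub, ← homologyMap_comp, copies_retr]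
  · intro n
    have := epi_homologyMap_aug M n
    have : Epi (homologyMap (fold M) n) := by
      refine epi_of_epi_fac (f := homologyMap (sigmaComplex.ι (fun _ => M) 0 : M ⟶ copies M) n)
        (h := 𝟙 _) ?_
      rw [← homologyMap_comp, fold, sigmaComplex.ι_desc, homologyMap_id]
    rw [homologyMap_comp]
    exact epi_comp _ _
  · intro n T x hx
    have := epi_homologyMap_aug M n
    rw [homologyMap_comp] at hx
    rw [hσ]
    exact telescope_exact (hst n) (hfold n) (fun T x hx => homologyMap_trans_of_aug M n x hx) x hx

end PartialRes

end KProjectiveResolution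

/-! ### Approximation of acyclic complexes -/

section Approximation

variable {C : Type u} [Category.{v} C] [Abelian C]

lemma shortExact_pushout {Ω P A A' : C} {ι : Ω ⟶ P} {π : P ⟶ A'} {z : ι ≫ π = 0}
    (hS : (ShortComplex.mk ι π z).ShortExact) (v : Ω ⟶ A) :
    (ShortComplex.mk (pushout.inl v ι) (pushout.desc 0 π (by simp [z])) (pushout.inl_desc _ _ _)).ShortExact := by
  have : Mono ι := hS.mono_f
  have : Epi π := hS.epi_g
  have : Epi (pushout.desc (f := v) (g := ι) 0 π (by simp [z])) :=
    epi_of_epi_fac (pushout.inr_desc 0 π _)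
  exact
    { exact := ShortComplex.exact_of_g_is_cokernel _ (CokernelCofork.IsColimit.ofπ _ _
        (fun {W} k hk => hS.exact.desc (pushout.inr v ι ≫ k) (by
          have := pushout.condition (f := v) (g := ι)
          change ι ≫ _ ≫ k = 0
          rw [← reassoc_of% this, hk, comp_zero]))
        (fun {W} k hk => by
          have := hS.exact.g_desc (pushout.inr v ι ≫ k) (by
            have := pushout.condition (f := v) (g := ι)
            change ι ≫ _ ≫ k = 0
            rw [← reassoc_of% this, hk, comp_zero])
          refine pushout.hom_ext ?_ ?_
          · rw [pushout.inl_desc_assoc, zero_comp, hk]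
          · rw [pushout.inr_desc_assoc]
            exact this)
        (fun {W} k hk l hl => by
          refine (cancel_epi (pushout.desc (f := v) (g := ι) 0 π _)).1 ?_
          rw [hl]
          refine pushout.hom_ext ?_ ?_
          · exact hk.trans (zero_comp.symm.trans (pushout.inl_desc_assoc _ _ _ _).symm)
          · rw [pushout.inr_desc_assoc]
            exact (hS.exact.g_desc _ _).symm))
      mono_f := inferInstance
      epi_g := this }

/-- The horseshoe lemma for special precovers. -/
lemma CHPair.horseshoe [EnoughProjectives C] {X Y : ObjectProperty C} (h : CHPair X Y)
    {Z E Z' B A A' : C} {i : Z ⟶ E} {q : E ⟶ Z'} {hiq : i ≫ q = 0}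
    (hE : (ShortComplex.mk i q hiq).ShortExact)
    {b : B ⟶ A} {a : A ⟶ Z} {hba : b ≫ a = 0} (hA : (ShortComplex.mk b a hba).ShortExact)
    (a' : A' ⟶ Z') (hB : Y B) (hA' : X A') :
    ∃ (F : C) (j : A ⟶ F) (r : F ⟶ A') (p : F ⟶ E) (z : j ≫ r = 0),
      (ShortComplex.mk j r z).ShortExact ∧ j ≫ p = a ≫ i ∧ p ≫ q = r ≫ a' := by
  have : Epi q := hE.epi_g
  have : Mono i := hE.mono_f
  let π := Projective.π A'
  have hΩ : (ShortComplex.mk (kernel.ι π) π (kernel.condition π)).ShortExact :=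
    { exact := ShortComplex.exact_kernel _
      mono_f := inferInstance
      epi_g := inferInstanceAs (Epi π) }
  -- Heredity is used here: the syzygy of an object of `X` is again in `X`.
  have hXΩ : X (kernel π) := h.ker_left hΩ (h.proj _ (inferInstance : Projective (Projective.over A'))) hA'
  let l : Projective.over A' ⟶ E := Projective.factorThru (π ≫ a') q
  have hl : l ≫ q = π ≫ a' := Projective.factorThru_comp _ _
  let w : kernel π ⟶ Z := hE.exact.lift (kernel.ι π ≫ l) (by
    change (_ ≫ _) ≫ q = 0
    rw [Category.assoc, hl, kernel.condition_assoc, zero_comp])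
  have hw : w ≫ i = kernel.ι π ≫ l := hE.exact.lift_f _ _
  -- `w` represents the pullback of the extension `E` along `a'`. Lifting it through `a` gives an
  -- extension of `A'` by `A` mapping to it, realized as a pushout.
  obtain ⟨v, hv⟩ := h.lift hA hB hXΩ w
  have hv' : v ≫ a = w := hv
  refine ⟨pushout v (kernel.ι π), pushout.inl _ _, pushout.desc 0 π (by simp),
    pushout.desc (a ≫ i) l (by rw [reassoc_of% hv', hw]), pushout.inl_desc _ _ _,
    shortExact_pushout hΩ v, pushout.inl_desc _ _ _, ?_⟩
  refine pushout.hom_ext ?_ ?_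
  · rw [pushout.inl_desc_assoc, pushout.inl_desc_assoc, Category.assoc, hiq]
    simp
  · rw [pushout.inr_desc_assoc, pushout.inr_desc_assoc, hl]

/-- The kernels in a short exact sequence of short exact sequences. -/
lemma shortExact_kernels {Z E Z' B A B' A' F : C} {i : Z ⟶ E} {q : E ⟶ Z'} {hiq : i ≫ q = 0}
    (hE : (ShortComplex.mk i q hiq).ShortExact)
    {b : B ⟶ A} {a : A ⟶ Z} {hba : b ≫ a = 0} (hA : (ShortComplex.mk b a hba).ShortExact)
    {b' : B' ⟶ A'} {a' : A' ⟶ Z'} {hba' : b' ≫ a' = 0}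
    (hA' : (ShortComplex.mk b' a' hba').ShortExact)
    {j : A ⟶ F} {r : F ⟶ A'} {hjr : j ≫ r = 0} (hF : (ShortComplex.mk j r hjr).ShortExact)
    {p : F ⟶ E} (hjp : j ≫ p = a ≫ i) (hpq : p ≫ q = r ≫ a') :
    Epi p ∧ ∃ (j' : B ⟶ kernel p) (r' : kernel p ⟶ B') (z : j' ≫ r' = 0),
      (ShortComplex.mk j' r' z).ShortExact ∧ j' ≫ kernel.ι p = b ≫ j ∧
        r' ≫ b' = kernel.ι p ≫ r := by
  have : Epi q := hE.epi_g
  have : Mono i := hE.mono_f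
  have : Epi a := hA.epi_g
  have : Mono b := hA.mono_f
  have : Epi a' := hA'.epi_g
  have : Mono b' := hA'.mono_f
  have : Epi r := hF.epi_g
  have : Mono j := hF.mono_f
  let j' : B ⟶ kernel p := kernel.lift p (b ≫ j) (by rw [Category.assoc, hjp, reassoc_of% hba, zero_comp])
  have hj' : j' ≫ kernel.ι p = b ≫ j := kernel.lift_ι _ _ _
  let r' : kernel p ⟶ B' := hA'.exact.lift (kernel.ι p ≫ r) (by
    change (_ ≫ _) ≫ a' = 0
    rw [Category.assoc, ← hpq, kernel.condition_assoc, zero_comp])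
  have hr' : r' ≫ b' = kernel.ι p ≫ r := hA'.exact.lift_f _ _
  have hz : j' ≫ r' = 0 := by
    rw [← cancel_mono b', Category.assoc, hr', reassoc_of% hj', hjr, comp_zero, zero_comp]
  have : Mono j' := by
    have : Mono (j' ≫ kernel.ι p) := by rw [hj']; infer_instance
    exact mono_of_mono j' (kernel.ι p)
  have : Epi r' := by
    rw [epi_iff_surjective_up_to_refinements]
    intro T x
    obtain ⟨T₁, π₁, hπ₁, y, hy⟩ := surjective_up_to_refinements_of_epi r (x ≫ b')
    have hyq : (y ≫ p) ≫ q = 0 := by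
      rw [Category.assoc, hpq, ← reassoc_of% hy, hba', comp_zero, comp_zero]
    obtain ⟨T₂, π₂, hπ₂, v, hv⟩ := surjective_up_to_refinements_of_epi a (hE.exact.lift (y ≫ p) hyq)
    have hv' : π₂ ≫ y ≫ p = v ≫ a ≫ i := by
      rw [← reassoc_of% hv]
      congr 1
      exact (hE.exact.lift_f _ _).symm
    refine ⟨T₂, π₂ ≫ π₁, epi_comp _ _, kernel.lift p (π₂ ≫ y - v ≫ j) ?_, ?_⟩
    · rw [Preadditive.sub_comp, Category.assoc, Category.assoc, hjp, hv', sub_self]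
    · rw [← cancel_mono b', Category.assoc, Category.assoc, Category.assoc, hr', kernel.lift_ι_assoc, hy,
        Preadditive.sub_comp, Category.assoc, Category.assoc, hjr, comp_zero, sub_zero]
  refine ⟨?_, j', r', hz, ⟨?_⟩, hj', hr'⟩
  · rw [epi_iff_surjective_up_to_refinements]
    intro T x
    obtain ⟨T₁, π₁, hπ₁, y, hy⟩ := surjective_up_to_refinements_of_epi (r ≫ a') (x ≫ q)
    have hyq : (π₁ ≫ x - y ≫ p) ≫ q = 0 := by
      rw [Preadditive.sub_comp, Category.assoc, Category.assoc, hpq, hy, sub_self]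
    obtain ⟨T₂, π₂, hπ₂, v, hv⟩ := surjective_up_to_refinements_of_epi a (hE.exact.lift _ hyq)
    have hv' : π₂ ≫ (π₁ ≫ x - y ≫ p) = v ≫ a ≫ i := by
      rw [← reassoc_of% hv]
      congr 1
      exact (hE.exact.lift_f _ _).symm
    refine ⟨T₂, π₂ ≫ π₁, epi_comp _ _, π₂ ≫ y + v ≫ j, ?_⟩
    rw [Preadditive.add_comp, Category.assoc, Category.assoc, Category.assoc, hjp, ← hv',
      Preadditive.comp_sub]
    abel
  · rw [ShortComplex.exact_iff_exact_up_to_refinements]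
    intro T g hg
    change g ≫ r' = 0 at hg
    have hg' : (g ≫ kernel.ι p) ≫ r = 0 := by
      rw [Category.assoc, ← hr', reassoc_of% hg, zero_comp]
    have h₁ : hF.exact.lift _ hg' ≫ j = g ≫ kernel.ι p := hF.exact.lift_f _ _
    have h₂ : hF.exact.lift _ hg' ≫ a = 0 := by
      rw [← cancel_mono i, Category.assoc, ← hjp, reassoc_of% h₁, kernel.condition, comp_zero,
        zero_comp]
    have h₃ : hA.exact.lift _ h₂ ≫ b = hF.exact.lift _ hg' := hA.exact.lift_f _ _
    refine ⟨T, 𝟙 T, inferInstance, hA.exact.lift _ h₂, ?_⟩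
    change 𝟙 T ≫ g = _ ≫ j'
    rw [← cancel_mono (kernel.ι p), Category.assoc, Category.assoc, hj', reassoc_of% h₃, h₁,
      Category.id_comp]

/-! Complexes obtained by splicing short exact sequences -/

section Glue

variable {Z F : ℤ → C} (i : ∀ n, Z n ⟶ F n) (q : ∀ n, F n ⟶ Z (n + 1))
  (hiq : ∀ n, i n ≫ q n = 0)

/-- The complex obtained by splicing short exact sequences. -/
abbrev glue : CochainComplex C ℤ :=
  CochainComplex.of F (fun n => q n ≫ i (n + 1)) (fun n => by simp [reassoc_of% hiq])

lemma glue_d (n : ℤ) : (glue i q hiq).d n (n + 1) = q n ≫ i (n + 1) :=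
  CochainComplex.of_d F (fun n => q n ≫ i (n + 1)) n

end Glue

lemma tildeClass_of_shortExact (P : ObjectProperty C) [P.IsClosedUnderIsomorphisms]
    (M : CochainComplex C ℤ) {Z : ℤ → C} (i : ∀ n, Z n ⟶ M.X n) (q : ∀ n, M.X n ⟶ Z (n + 1))
    (hiq : ∀ n, i n ≫ q n = 0) (h : ∀ n, (ShortComplex.mk _ _ (hiq n)).ShortExact)
    (hd : ∀ n, M.d n (n + 1) = q n ≫ i (n + 1)) (hZ : ∀ n, P (Z n)) : tildeClass P M := by
  have hi (n : ℤ) : Mono (i n) := (h n).mono_f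
  have hq (n : ℤ) : Epi (q n) := (h n).epi_g
  have hid (n : ℤ) : i n ≫ M.d n (n + 1) = 0 := by rw [hd, reassoc_of% hiq, zero_comp]
  have hl {n : ℤ} {W : C} (k : W ⟶ M.X n) (hk : k ≫ M.d n (n + 1) = 0) :
      ∃ l : W ⟶ Z n, l ≫ i n = k := by
    have hk' : k ≫ q n = 0 := by
      rw [← cancel_mono (i (n + 1)), Category.assoc, ← hd, hk, zero_comp]
    exact ⟨(h n).exact.lift k hk', (h n).exact.lift_f _ _⟩
  refine ⟨fun n => ?_, fun n => ?_⟩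
  · obtain ⟨m, rfl⟩ : ∃ m, n = m + 1 := ⟨n - 1, by simp⟩
    rw [M.exactAt_iff_exact_up_to_refinements m (m + 1) (m + 1 + 1) (by simp) (by simp)]
    intro T x hx
    obtain ⟨l, hl⟩ := hl x hx
    obtain ⟨T', π, hπ, y, hy⟩ := surjective_up_to_refinements_of_epi (q m) l
    exact ⟨T', π, hπ, y, by rw [hd, ← reassoc_of% hy, hl]⟩
  · have hZn : IsLimit (KernelFork.ofι (i n) (hid n)) :=
      KernelFork.IsLimit.ofι _ _ (fun k hk => (hl k hk).choose)
        (fun k hk => (hl k hk).choose_spec)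
        (fun k hk m hm => by rw [← cancel_mono (i n), hm, (hl k hk).choose_spec])
    exact P.prop_of_iso (IsLimit.conePointUniqueUpToIso hZn
      (M.cyclesIsKernel n (n + 1) (by simp))) (hZ n)

lemma shortExact_cycles {M : CochainComplex C ℤ} (hM : M.Acyclic) (n : ℤ) :
    (ShortComplex.mk (M.iCycles n) (M.toCycles n (n + 1))
      (by rw [← cancel_mono (M.iCycles _)]; simp)).ShortExact := by
  have h := hM (n + 1)
  rw [M.exactAt_iff_exact_up_to_refinements n (n + 1) (n + 1 + 1) (by simp) (by simp)] at h
  refine { exact := ?_, mono_f := inferInstanceAs (Mono (M.iCycles n)), epi_g := ?_ }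
  · rw [ShortComplex.exact_iff_exact_up_to_refinements]
    intro T x hx
    have hx' : x ≫ M.d n (n + 1) = 0 := by
      have := hx =≫ M.iCycles (n + 1)
      simpa using this
    exact ⟨T, 𝟙 T, inferInstance, M.liftCycles x (n + 1) (by simp) hx', by simp⟩
  · change Epi (M.toCycles n (n + 1))
    rw [epi_iff_surjective_up_to_refinements]
    intro T x
    obtain ⟨T', π, hπ, y, hy⟩ := h (x ≫ M.iCycles (n + 1)) (by simp)
    exact ⟨T', π, hπ, y, by rw [← cancel_mono (M.iCycles (n + 1))]; simpa using hy⟩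

/-- Acyclic complexes have special precovers by complexes in `tildeClass X`. -/
lemma CHPair.exists_tildeClass_precover [EnoughProjectives C] {X Y : ObjectProperty C}
    (h : CHPair X Y) (E : CochainComplex C ℤ) (hE : E.Acyclic) :
    ∃ (B A : CochainComplex C ℤ) (j : B ⟶ A) (p : A ⟶ E) (w : j ≫ p = 0),
      (ShortComplex.mk j p w).ShortExact ∧ tildeClass X A ∧ tildeClass Y B := by
  have := h.iso_left
  have := h.iso_right
  -- One precover is fixed for each cycle object, so the extension in degree n ends with the object
  -- with which that in degree n + 1 begins. Hence both the extensions and their kernels can be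
  -- spliced.
  choose B A b a hba hA hXA hYB using fun n => h.complete_left (E.cycles n)
  choose F j r p hjr hF hjp hpq using fun n =>
    h.horseshoe (shortExact_cycles hE n) (hA n) (a (n + 1)) (hYB n) (hXA (n + 1))
  choose hp j' r' hjr' hK hj' hr' using fun n =>
    shortExact_kernels (shortExact_cycles hE n) (hA n) (hA (n + 1)) (hF n) (hjp n) (hpq n)
  have hd (n : ℤ) : (r' n ≫ j' (n + 1)) ≫ kernel.ι (p (n + 1)) =
      kernel.ι (p n) ≫ r n ≫ j (n + 1) := by
    rw [Category.assoc, hj', reassoc_of% hr']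
  have hd' (n : ℤ) : (r n ≫ j (n + 1)) ≫ p (n + 1) = p n ≫ E.d n (n + 1) := by
    rw [Category.assoc, hjp, ← reassoc_of% hpq, E.toCycles_i]
  let κ : glue j' r' hjr' ⟶ glue j r hjr := CochainComplex.ofHom (fun n => kernel.ι (p n))
    (fun n => by rw [glue_d, glue_d]; exact (hd n).symm)
  let P : glue j r hjr ⟶ E := CochainComplex.ofHom p
    (fun n => by rw [glue_d]; exact (hd' n).symm)
  refine ⟨_, _, κ, P, ?_, HomologicalComplex.shortExact_of_degreewise_shortExact _ fun n => ?_, ?_, ?_⟩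
  · ext n
    exact kernel.condition (p n)
  · have := hp n
    exact
      { exact := ShortComplex.exact_kernel (p n)
        mono_f := inferInstanceAs (Mono (kernel.ι (p n)))
        epi_g := inferInstanceAs (Epi (p n)) }
  · exact tildeClass_of_shortExact X _ j r hjr hF (glue_d j r hjr) hXA
  · exact tildeClass_of_shortExact Y _ j' r' hjr' hK (glue_d j' r' hjr') hYB

end Approximation

/-! ### Null-homotopic morphisms and orthogonality -/

section Orthogonality

variable {C : Type u} [Category.{v} C] [Abelian C]

/-- The null-homotopic morphism attached to a family of morphisms of degree `-1`. -/
def nullMap {K L : CochainComplex C ℤ} (h : ∀ n, K.X (n + 1) ⟶ L.X n) : K ⟶ L :=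
  Homotopy.nullHomotopicMap' fun _ q hpq => (K.XIsoOfEq (Eq.symm hpq)).hom ≫ h q

lemma nullMap_f {K L : CochainComplex C ℤ} (h : ∀ n, K.X (n + 1) ⟶ L.X n) (n : ℤ) :
    (nullMap h).f (n + 1) = K.d (n + 1) (n + 1 + 1) ≫ h (n + 1) + h n ≫ L.d n (n + 1) := by
  rw [nullMap, Homotopy.nullHomotopicMap'_f (k₂ := n) (k₀ := n + 1 + 1) rfl rfl]
  simp

lemma nullMap_homotopy {K L : CochainComplex C ℤ} (h : ∀ n, K.X (n + 1) ⟶ L.X n) :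
    Nonempty (Homotopy (nullMap h) 0) :=
  ⟨Homotopy.nullHomotopy' _⟩

/-- A constructor for null-homotopies. -/
lemma nonempty_homotopy_zero {K L : CochainComplex C ℤ} (f : K ⟶ L)
    (h : ∀ n, K.X (n + 1) ⟶ L.X n)
    (hf : ∀ n, f.f (n + 1) = K.d (n + 1) (n + 1 + 1) ≫ h (n + 1) + h n ≫ L.d n (n + 1)) :
    Nonempty (Homotopy f 0) := by
  obtain rfl : f = nullMap h := by
    ext n
    obtain ⟨m, rfl⟩ : ∃ m, n = m + 1 := ⟨n - 1, by simp⟩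
    rw [hf, nullMap_f]
  exact nullMap_homotopy h

variable {X Y : ObjectProperty C} (h : CHPair X Y)

include h

lemma CHPair.prop_X_of_tildeClass_left {K : CochainComplex C ℤ} (hK : tildeClass X K) (n : ℤ) :
    X (K.X n) :=
  h.ext_left (shortExact_cycles hK.1 n) (hK.2 n) (hK.2 (n + 1))

lemma CHPair.prop_X_of_tildeClass_right {K : CochainComplex C ℤ} (hK : tildeClass Y K) (n : ℤ) :
    Y (K.X n) :=
  h.ext_right (shortExact_cycles hK.1 n) (hK.2 n) (hK.2 (n + 1))

open HomologicalComplex in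
-- The homotopy is built in two stages: one to make the morphism vanish on cycles, another for the
-- map then induced on quotients. Every choice is a lifting or extension problem with obstruction in
-- an Ext¹(X, Y).
lemma CHPair.homotopy_zero_of_tildeClass {A N : CochainComplex C ℤ} (hA : tildeClass X A)
    (hN : tildeClass Y N) (f : A ⟶ N) : Nonempty (Homotopy f 0) := by
  have hepi (n : ℤ) : Epi (A.toCycles n (n + 1)) := (shortExact_cycles hA.1 n).epi_g
  -- On cycles, `f` lifts through the differential of `N`; `β` extends this lift to all of `A` and
  -- will be subtracted as a null-homotopy.
  have hα (n : ℤ) : ∃ α : A.cycles (n + 1) ⟶ N.X n,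
      α ≫ N.toCycles n (n + 1) = cyclesMap f (n + 1) :=
    h.lift (shortExact_cycles hN.1 n) (hN.2 n) (hA.2 _) _
  choose α hα using hα
  have hβ (n : ℤ) : ∃ β : A.X (n + 1) ⟶ N.X n, A.iCycles (n + 1) ≫ β = α n :=
    h.extend (shortExact_cycles hA.1 (n + 1)) (hA.2 _) (h.prop_X_of_tildeClass_right hN n) _
  choose β hβ using hβ
  let f' : A ⟶ N := f - nullMap β
  have hf'i (n : ℤ) : A.iCycles n ≫ f'.f n = 0 := by
    obtain ⟨m, rfl⟩ : ∃ m, n = m + 1 := ⟨n - 1, by simp⟩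
    have : A.iCycles (m + 1) ≫ f.f (m + 1) = α m ≫ N.d m (m + 1) := by
      rw [← cyclesMap_i, ← hα, Category.assoc, toCycles_i]
    rw [HomologicalComplex.sub_f_apply, nullMap_f, Preadditive.comp_sub, Preadditive.comp_add, this,
      iCycles_d_assoc, zero_comp, reassoc_of% hβ, zero_add, sub_self]
  have hg (n : ℤ) : ∃ g : A.cycles (n + 1) ⟶ N.X n, A.toCycles n (n + 1) ≫ g = f'.f n :=
    ⟨(shortExact_cycles hA.1 n).exact.desc (f'.f n) (hf'i n),
      (shortExact_cycles hA.1 n).exact.g_desc _ _⟩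
  choose g hg using hg
  have hgd (n : ℤ) : g n ≫ N.d n (n + 1) = 0 := by
    rw [← cancel_epi (A.toCycles n (n + 1)), reassoc_of% hg, f'.comm, comp_zero,
      ← A.toCycles_i, Category.assoc, hf'i, comp_zero]
  -- The extension of `g` is taken with values in the cycles of `N`, so that its composite with the
  -- differential of `N` contributes nothing.
  have hε (n : ℤ) : ∃ ε : A.X (n + 1) ⟶ N.cycles n, A.iCycles (n + 1) ≫ ε =
      N.liftCycles (g n) (n + 1) (by simp) (hgd n) :=
    h.extend (shortExact_cycles hA.1 (n + 1)) (hA.2 _) (hN.2 _) _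
  choose ε hε using hε
  have hf' : f' = nullMap (fun n => ε n ≫ N.iCycles n) := by
    ext n
    obtain ⟨m, rfl⟩ : ∃ m, n = m + 1 := ⟨n - 1, by simp⟩
    rw [nullMap_f, ← hg, ← A.toCycles_i, Category.assoc, reassoc_of% hε, Category.assoc,
      iCycles_d, comp_zero, add_zero, liftCycles_i]
  have hf : f = nullMap β + nullMap (fun n => ε n ≫ N.iCycles n) := by
    rw [← hf']
    simp [f']
  obtain ⟨h₁⟩ := nullMap_homotopy β
  obtain ⟨h₂⟩ := nullMap_homotopy (fun n => ε n ≫ N.iCycles n)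
  exact ⟨(Homotopy.ofEq hf).trans ((h₁.add h₂).trans (Homotopy.ofEq (add_zero 0)))⟩

lemma CHPair.dgLeft_of_tildeClass {K : CochainComplex C ℤ} (hK : tildeClass X K) :
    dgLeft X Y K :=
  ⟨h.prop_X_of_tildeClass_left hK, fun _ hN f => h.homotopy_zero_of_tildeClass hK hN f⟩

lemma CHPair.dgLeft_of_isKProjective (P : CochainComplex C ℤ) [P.IsKProjective]
    (hP : ∀ n, Projective (P.X n)) : dgLeft X Y P :=
  ⟨fun n => h.proj _ (hP n), fun _ hN f =>
    CochainComplex.IsKProjective.nonempty_homotopy_zero f hN.1⟩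

lemma CHPair.rac_of_tildeClass {K : CochainComplex C ℤ} (hK : tildeClass Y K) : rac X K := by
  rintro A hA i j k rfl rfl g
  constructor
  · intro hg
    obtain ⟨l, hl⟩ := h.lift (shortExact_cycles hK.1 i) (hK.2 i) hA
      (K.liftCycles g (i + 1 + 1) (by simp) hg)
    refine ⟨l, ?_⟩
    have := hl =≫ K.iCycles _
    simpa using this
  · rintro ⟨l, rfl⟩
    simp

/-- Projective covers lie in `X` and detect exactness. -/
lemma CHPair.acyclic_of_rac [EnoughProjectives C] {K : CochainComplex C ℤ} (hK : rac X K) :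
    K.Acyclic := by
  intro n
  rw [K.exactAt_iff_exact_up_to_refinements (n - 1) n (n + 1) (by simp) (by simp)]
  intro T x hx
  obtain ⟨y, hy⟩ := (hK (Projective.over T) (h.proj _ inferInstance) (n - 1) n (n + 1) (by lia) rfl
    (Projective.π T ≫ x)).1 (by simp [hx])
  exact ⟨_, Projective.π T, inferInstance, y, hy.symm⟩

omit h in
/-- Complexes in `tildeClass X` which are right `X`-acyclic are contractible. -/
lemma homotopy_id_zero_of_rac {A : CochainComplex C ℤ} (hA : tildeClass X A) (hA' : rac X A) :
    Nonempty (Homotopy (𝟙 A) 0) := by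
  -- The cycles are themselves test objects in `X`: their inclusion is a cocycle of the Hom complex,
  -- and bounding it splits the sequence of cycles.
  have hr (n : ℤ) : ∃ r : A.cycles (n + 1) ⟶ A.X n, r ≫ A.d n (n + 1) = A.iCycles (n + 1) :=
    (hA' _ (hA.2 (n + 1)) n (n + 1) (n + 1 + 1) rfl rfl (A.iCycles (n + 1))).1 (by simp)
  choose r hr using hr
  have hr' (n : ℤ) : r n ≫ A.toCycles n (n + 1) = 𝟙 _ := by
    rw [← cancel_mono (A.iCycles (n + 1)), Category.assoc, A.toCycles_i, hr, Category.id_comp]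
  let l (n : ℤ) : A.X n ⟶ A.cycles n := A.liftCycles (𝟙 _ - A.toCycles n (n + 1) ≫ r n) (n + 1)
    (by simp) (by simp [hr])
  have hl (n : ℤ) : l n ≫ A.iCycles n = 𝟙 _ - A.toCycles n (n + 1) ≫ r n :=
    A.liftCycles_i _ _ _ _
  have hl' (n : ℤ) : A.iCycles n ≫ l n = 𝟙 _ := by
    have : A.iCycles n ≫ A.toCycles n (n + 1) = 0 := by
      rw [← cancel_mono (A.iCycles _)]
      simp
    rw [← cancel_mono (A.iCycles n), Category.assoc, hl, Preadditive.comp_sub, reassoc_of% this]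
    simp
  refine nonempty_homotopy_zero _ (fun n => l (n + 1) ≫ r n) fun n => ?_
  rw [Category.assoc, hr, hl, ← A.toCycles_i, Category.assoc, reassoc_of% hl', HomologicalComplex.id_f]
  simp

omit h in
lemma shortExact_f {B A E : CochainComplex C ℤ} {j : B ⟶ A} {p : A ⟶ E} {w : j ≫ p = 0}
    (hS : (ShortComplex.mk j p w).ShortExact) (n : ℤ) :
    (ShortComplex.mk (j.f n) (p.f n)
      (by rw [← HomologicalComplex.comp_f, w, HomologicalComplex.zero_f])).ShortExact :=
  hS.map_of_exact (HomologicalComplex.eval C (ComplexShape.up ℤ) n)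

omit h in
-- A cocycle of `A` killed by `p` comes from a cocycle of `B`, where it bounds.
lemma exists_lift_cocycle {B A E : CochainComplex C ℤ} {j : B ⟶ A} {p : A ⟶ E} {w : j ≫ p = 0}
    (hS : (ShortComplex.mk j p w).ShortExact) (hB : rac X B) {T : C} (hT : X T) (n : ℤ)
    (x : T ⟶ A.X (n + 1)) (hx : x ≫ A.d (n + 1) (n + 1 + 1) = 0) (hxp : x ≫ p.f (n + 1) = 0) :
    ∃ c : T ⟶ B.X n, c ≫ j.f n ≫ A.d n (n + 1) = x := by
  have hj (n : ℤ) : Mono (j.f n) := (shortExact_f hS n).mono_f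
  have hb : (shortExact_f hS (n + 1)).exact.lift x hxp ≫ j.f (n + 1) = x :=
    (shortExact_f hS (n + 1)).exact.lift_f _ _
  obtain ⟨c, hc⟩ := (hB T hT n (n + 1) (n + 1 + 1) rfl rfl _).1
    (show (shortExact_f hS (n + 1)).exact.lift x hxp ≫ B.d (n + 1) (n + 1 + 1) = 0 by
      rw [← cancel_mono (j.f (n + 1 + 1)), Category.assoc, ← j.comm, reassoc_of% hb, hx, zero_comp])
  exact ⟨c, by rw [j.comm, reassoc_of% hc, hb]⟩

/-- Hom out of an object of `X` keeps the sequence exact in each degree, since the terms of `B` are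
in `Y`; the middle complex is then exact because the outer two are. -/
lemma CHPair.rac_of_shortExact {B A E : CochainComplex C ℤ} {j : B ⟶ A} {p : A ⟶ E} {w : j ≫ p = 0}
    (hS : (ShortComplex.mk j p w).ShortExact) (hB : tildeClass Y B) (hE : rac X E) : rac X A := by
  rintro T hT i _ _ rfl rfl x
  constructor
  · intro hx
    obtain ⟨y, hy⟩ := (hE T hT i (i + 1) (i + 1 + 1) rfl rfl (x ≫ p.f (i + 1))).1 (by
      dsimp at hx ⊢
      rw [Category.assoc, p.comm, reassoc_of% hx, zero_comp])
    obtain ⟨u, hu⟩ := h.lift (shortExact_f hS i) (h.prop_X_of_tildeClass_right hB i) hT y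
    have hu' : u ≫ p.f i = y := hu
    obtain ⟨c, hc⟩ := exists_lift_cocycle hS (h.rac_of_tildeClass hB) hT i (x - u ≫ A.d i (i + 1))
      (by dsimp at hx; simp [hx]) (by
        dsimp at hy
        rw [Preadditive.sub_comp, Category.assoc, ← p.comm, reassoc_of% hu', hy, sub_self])
    refine ⟨u + c ≫ j.f i, ?_⟩
    dsimp
    rw [Preadditive.add_comp, Category.assoc, hc]
    abel
  · rintro ⟨l, rfl⟩
    simp

open CochainComplex in
-- After applying Hom out of an object of `X`, `p` is surjective with exact kernel, hence has exact
-- cone. Concretely, for a cocycle (a, e), lift e to u; then a + du comes from `B` and bounds there,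
-- and u corrected by that primitive bounds (a, e).
lemma CHPair.rac_mappingCone {B A E : CochainComplex C ℤ} {j : B ⟶ A} {p : A ⟶ E} {w : j ≫ p = 0}
    (hS : (ShortComplex.mk j p w).ShortExact) (hB : tildeClass Y B) : rac X (mappingCone p) := by
  rintro T hT i _ _ rfl rfl x
  constructor
  · intro hx
    dsimp at hx
    obtain ⟨a, e, rfl⟩ : ∃ (a : T ⟶ A.X (i + 1 + 1)) (e : T ⟶ E.X (i + 1)),
        x = a ≫ (mappingCone.inl p).v (i + 1 + 1) (i + 1) (by lia) +
          e ≫ (mappingCone.inr p).f (i + 1) := by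
      refine ⟨x ≫ (mappingCone.fst p).1.v (i + 1) (i + 1 + 1) rfl,
        x ≫ (mappingCone.snd p).v (i + 1) (i + 1) (by lia), ?_⟩
      rw [Category.assoc, Category.assoc, ← Preadditive.comp_add, mappingCone.id_X,
        Category.comp_id]
    have hd : a ≫ A.d (i + 1 + 1) (i + 1 + 1 + 1) = 0 ∧
        a ≫ p.f (i + 1 + 1) + e ≫ E.d (i + 1) (i + 1 + 1) = 0 := by
      rw [Preadditive.add_comp, Category.assoc, Category.assoc,
        mappingCone.inl_v_d p (i + 1 + 1) (i + 1) (i + 1 + 1 + 1) (by lia) (by lia),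
        (mappingCone.inr p).comm, Preadditive.comp_sub] at hx
      constructor
      · have := hx =≫ (mappingCone.fst p).1.v (i + 1 + 1) (i + 1 + 1 + 1) rfl
        simpa using this
      · have := hx =≫ (mappingCone.snd p).v (i + 1 + 1) (i + 1 + 1) (by lia)
        simpa using this
    obtain ⟨u, hu⟩ := h.lift (shortExact_f hS (i + 1)) (h.prop_X_of_tildeClass_right hB _) hT e
    have hu' : u ≫ p.f (i + 1) = e := hu
    obtain ⟨c, hc⟩ := exists_lift_cocycle hS (h.rac_of_tildeClass hB) hT (i + 1)
      (a + u ≫ A.d (i + 1) (i + 1 + 1)) (by simp [hd.1]) (by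
        rw [Preadditive.add_comp, Category.assoc, ← p.comm, reassoc_of% hu', hd.2])
    have hjp : j.f (i + 1) ≫ p.f (i + 1) = 0 := by
      rw [← HomologicalComplex.comp_f, w, HomologicalComplex.zero_f]
    refine ⟨(u - c ≫ j.f (i + 1)) ≫ (mappingCone.inl p).v (i + 1) i (by lia), ?_⟩
    dsimp
    rw [Category.assoc, mappingCone.inl_v_d p (i + 1) i (i + 1 + 1) (by lia) (by lia),
      Preadditive.comp_sub, Preadditive.sub_comp, Preadditive.sub_comp, reassoc_of% hu',
      Category.assoc, reassoc_of% hjp, zero_comp, comp_zero, sub_zero, Category.assoc,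
      reassoc_of% hc, Preadditive.add_comp, Category.assoc]
    abel
  · rintro ⟨l, rfl⟩
    simp

open CochainComplex CochainComplex.HomComplex in
omit h in
-- A cocycle of degree 1 is a morphism to `B⟦1⟧`, which has cycles in `Y` as well.
lemma exists_δ_eq_of_dgLeft [Y.IsClosedUnderIsomorphisms] {P B : CochainComplex C ℤ}
    (hP : dgLeft X Y P) (hB : tildeClass Y B) (z : Cocycle P B 1) :
    ∃ b : Cochain P B 0, δ 0 1 b = z.1 := by
  have := (CohomologyClass.toHom_mk_eq_zero_iff z).1
    ((homotopy_iff _ _ _).1 (hP.2 _ (tildeClass_shift Y inferInstance B hB 1) _))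
  exact (mem_coboundaries_iff z 0 rfl).1 this

open CochainComplex CochainComplex.HomComplex in
/-- Morphisms from `dgLeft X Y` lift along special precovers. -/
lemma CHPair.exists_lift_of_dgLeft {P B A E : CochainComplex C ℤ} {j : B ⟶ A} {p : A ⟶ E}
    {w : j ≫ p = 0} (hS : (ShortComplex.mk j p w).ShortExact) (hP : dgLeft X Y P)
    (hB : tildeClass Y B) (f : P ⟶ E) : ∃ g : P ⟶ A, g ≫ p = f := by
  have := h.iso_right
  have hj (n : ℤ) : Mono (j.f n) := (shortExact_f hS n).mono_f
  have hg (n : ℤ) : ∃ g : P.X n ⟶ A.X n, g ≫ p.f n = f.f n :=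
    h.lift (shortExact_f hS n) (h.prop_X_of_tildeClass_right hB n) (hP.1 n) (f.f n)
  choose g hg using hg
  let γ : Cochain P A 0 := Cochain.ofHoms g
  have hγ : γ.comp (Cochain.ofHom p) (add_zero 0) = Cochain.ofHom f := by
    ext n
    simp [γ, hg]
  have hγ' (m n : ℤ) (hmn : m + 1 = n) : (δ 0 1 γ).v m n hmn ≫ p.f n = 0 := by
    have : (δ 0 1 γ).comp (Cochain.ofHom p) (add_zero 1) = 0 := by
      rw [← δ_comp_ofHom, hγ, δ_ofHom]
    simpa using Cochain.congr_v this m n hmn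
  -- The degreewise lifts fail to commute with the differentials by a 1-cocycle with values in `B`;
  -- a primitive of it is the required correction.
  let c : Cochain P B 1 := Cochain.mk fun m n hmn => (shortExact_f hS n).exact.lift _ (hγ' m n hmn)
  have hc : c.comp (Cochain.ofHom j) (add_zero 1) = δ 0 1 γ := by
    ext m n hmn
    rw [Cochain.comp_zero_cochain_v, Cochain.ofHom_v]
    exact (shortExact_f hS n).exact.lift_f _ _
  have hc' : δ 1 2 c = 0 := by
    have : (δ 1 2 c).comp (Cochain.ofHom j) (add_zero 2) = 0 := by
      rw [← δ_comp_ofHom, hc, δ_δ]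
    ext m n hmn
    rw [← cancel_mono (j.f n)]
    simpa using Cochain.congr_v this m n hmn
  obtain ⟨b, hb⟩ := exists_δ_eq_of_dgLeft hP hB (Cocycle.mk c 2 rfl hc')
  let g' : Cocycle P A 0 := Cocycle.mk (γ - b.comp (Cochain.ofHom j) (add_zero 0)) 1 rfl (by
    rw [δ_sub, δ_comp_ofHom, hb, ← hc]
    exact sub_self _)
  refine ⟨Cocycle.homOf g', ?_⟩
  apply Cochain.ofHom_injective
  rw [Cochain.ofHom_comp, Cocycle.cochain_ofHom_homOf_eq_coe]
  change (γ - _).comp _ _ = _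
  rw [Cochain.sub_comp, hγ, Cochain.comp_assoc_of_third_is_zero_cochain, ← Cochain.ofHom_comp, w]
  simp

/-- Complexes in `dgLeft X Y` are left orthogonal to right `X`-acyclic complexes. -/
lemma CHPair.homotopy_zero_of_dgLeft [EnoughProjectives C] {P E : CochainComplex C ℤ}
    (hP : dgLeft X Y P) (hE : rac X E) (f : P ⟶ E) : Nonempty (Homotopy f 0) := by
  obtain ⟨B, A, j, p, w, hS, hA, hB⟩ := h.exists_tildeClass_precover E (h.acyclic_of_rac hE)
  obtain ⟨g, rfl⟩ := h.exists_lift_of_dgLeft hS hP hB f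
  -- `f` now factors through a contractible complex.
  obtain ⟨H⟩ := homotopy_id_zero_of_rac hA (h.rac_of_shortExact hS hB hE)
  exact ⟨(Homotopy.ofEq (by simp)).trans ((((H.compLeft g)).compRight p).trans
    (Homotopy.ofEq (by simp)))⟩

end Orthogonality

/-! ### Special precovers of complexes -/

section Precover

variable {C : Type u} [Category.{v} C] [Abelian C]

/-- The pullback of two short exact sequences along their common third and second terms. -/
lemma exists_shortExact_pullback {M E Q B A : C} {i : M ⟶ E} {q : E ⟶ Q} {z : i ≫ q = 0}
    (hE : (ShortComplex.mk i q z).ShortExact) {j : B ⟶ A} {p : A ⟶ E} {w : j ≫ p = 0}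
    (hA : (ShortComplex.mk j p w).ShortExact) :
    ∃ (N : C) (j' : B ⟶ N) (p' : N ⟶ M) (k : N ⟶ A) (w' : j' ≫ p' = 0) (z' : k ≫ p ≫ q = 0),
      (ShortComplex.mk j' p' w').ShortExact ∧ (ShortComplex.mk k (p ≫ q) z').ShortExact := by
  have : Mono i := hE.mono_f
  have : Epi q := hE.epi_g
  have : Mono j := hA.mono_f
  have : Epi p := hA.epi_g
  have hc := pullback.condition (f := p) (g := i)
  have hj : pullback.lift (f := p) (g := i) j 0 (by simp [w]) ≫ pullback.fst p i = j :=
    pullback.lift_fst _ _ _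
  refine ⟨pullback p i, pullback.lift j 0 (by simp [w]), pullback.snd p i, pullback.fst p i,
    pullback.lift_snd _ _ _, by rw [reassoc_of% hc, z, comp_zero], ?_, ?_⟩
  · refine { exact := ?_, mono_f := mono_of_mono_fac hj, epi_g := inferInstance }
    rw [ShortComplex.exact_iff_exact_up_to_refinements]
    intro T x hx
    have hx' : (x ≫ pullback.fst p i) ≫ p = 0 := by
      rw [Category.assoc, hc]
      exact (reassoc_of% hx) _ |>.trans zero_comp
    refine ⟨T, 𝟙 T, inferInstance, hA.exact.lift _ hx', ?_⟩
    have h₁ : hA.exact.lift _ hx' ≫ j = x ≫ pullback.fst p i := hA.exact.lift_f _ _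
    refine pullback.hom_ext ?_ ?_
    · exact (Category.assoc _ _ _).trans ((Category.id_comp _).trans (h₁.symm.trans
        ((congrArg (_ ≫ ·) hj.symm).trans (Category.assoc _ _ _).symm)))
    · exact (Category.assoc _ _ _).trans ((Category.id_comp _).trans (hx.trans
        (comp_zero.symm.trans ((congrArg (_ ≫ ·) (pullback.lift_snd _ _ _).symm).trans
          (Category.assoc _ _ _).symm))))
  · refine { exact := ?_, mono_f := inferInstance, epi_g := epi_comp _ _ }
    rw [ShortComplex.exact_iff_exact_up_to_refinements]
    intro T x hx
    have hx' : (x ≫ p) ≫ q = 0 := (Category.assoc _ _ _).trans hx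
    have h₁ : hE.exact.lift _ hx' ≫ i = x ≫ p := hE.exact.lift_f _ _
    exact ⟨T, 𝟙 T, inferInstance, pullback.lift x (hE.exact.lift _ hx') h₁.symm,
      (Category.id_comp _).trans (pullback.lift_fst _ _ _).symm⟩

open CochainComplex HomologicalComplex

variable {X Y : ObjectProperty C} (h : CHPair X Y)

include h

/-- Projectivity of the terms of `Q` splits the sequence degreewise, giving a distinguished triangle
in the homotopy category; the left orthogonal of K(Y-tilde) is closed under the third vertex. The
terms are in `X` by heredity. -/
lemma CHPair.dgLeft_of_shortExact {N A Q : CochainComplex C ℤ} {k : N ⟶ A} {q : A ⟶ Q}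
    {z : k ≫ q = 0} (hS : (ShortComplex.mk k q z).ShortExact) (hA : dgLeft X Y A)
    (hQ : dgLeft X Y Q) (hQ' : ∀ n, Projective (Q.X n)) : dgLeft X Y N := by
  have hX (n : ℤ) : X (N.X n) := h.ker_left (shortExact_f hS n) (hA.1 n) (hQ.1 n)
  have := homotopySubcat_shift (tildeClass Y) (fun M n hM => tildeClass_shift Y h.iso_right M hM n)
  let σ (n : ℤ) : ((ShortComplex.mk k q z).map (eval C _ n)).Splitting :=
    have : Projective ((ShortComplex.mk k q z).map (eval C (ComplexShape.up ℤ) n)).X₃ := hQ' n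
    (shortExact_f hS n).splittingOfProjective
  have hT : trianglehOfDegreewiseSplit _ σ ∈ distTriang _ :=
    (HomotopyCategory.distinguished_iff_iso_trianglehOfDegreewiseSplit _).2
      ⟨_, σ, ⟨Iso.refl _⟩⟩
  have hK (K : CochainComplex C ℤ) (hK : dgLeft X Y K) :
      (homotopySubcat (tildeClass Y)).leftOrthogonal ((HomotopyCategory.quotient C _).obj K) := by
    have : homotopySubcat (dgLeft X Y) ((HomotopyCategory.quotient C _).obj K) := hK
    rw [homotopySubcat_dgLeft] at this
    exact this.2
  have := ObjectProperty.ext_of_isTriangulatedClosed₁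
    (homotopySubcat (tildeClass Y)).leftOrthogonal _ hT (hK A hA) (hK Q hQ)
  have : homotopySubcat (dgLeft X Y) ((HomotopyCategory.quotient C _).obj N) := by
    rw [homotopySubcat_dgLeft]
    exact ⟨hX, this⟩
  exact this

variable [EnoughProjectives C] [EnoughInjectives C] [HasCoproductsOfShape ℕ C]

/-- Complexes have special precovers by complexes in `dgLeft X Y`. -/
lemma CHPair.exists_dgLeft_precover (M : CochainComplex C ℤ) :
    ∃ (B N : CochainComplex C ℤ) (j : B ⟶ N) (p : N ⟶ M) (w : j ≫ p = 0),
      (ShortComplex.mk j p w).ShortExact ∧ dgLeft X Y N ∧ tildeClass Y B := by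
  obtain ⟨P, f, hP, hP', hf⟩ := PartialRes.exists_quasiIso M
  have hf' : (mappingCone f).Acyclic := by
    have : HomotopyCategory.quasiIso C _ ((HomotopyCategory.quotient C _).map f) := by
      rwa [HomotopyCategory.quotient_map_mem_quasiIso_iff]
    rw [HomotopyCategory.quasiIso_eq_trW_subcategoryAcyclic] at this
    exact (HomotopyCategory.quotient_obj_mem_subcategoryAcyclic_iff_acyclic _).1
      ((ObjectProperty.trW_iff_of_distinguished _ _
        (HomotopyCategory.mappingCone_triangleh_distinguished f)).1 this)
  have hE : (mappingCone.triangleRotateShortComplex f).ShortExact :=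
    shortExact_of_degreewise_shortExact _ fun n =>
      (mappingCone.triangleRotateShortComplexSplitting f n).shortExact
  obtain ⟨B, A, j, p, w, hS, hA, hB⟩ := h.exists_tildeClass_precover _ hf'
  -- The pullback `N` of M ⟶ cone ⟵ A is an extension of `M` by `B`, and also the kernel of the
  -- composite of `A` onto `P⟦1⟧`.
  obtain ⟨N, j', p', k, w', z', h₁, h₂⟩ := exists_shortExact_pullback hE hS
  have hQ (n : ℤ) : Projective ((P⟦(1 : ℤ)⟧).X n) := hP' (n + 1)
  have : (P⟦(1 : ℤ)⟧).IsKProjective := inferInstance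
  have hQ' : dgLeft X Y (P⟦(1 : ℤ)⟧) := h.dgLeft_of_isKProjective _ hQ
  exact ⟨B, N, j', p', w', h₁, h.dgLeft_of_shortExact h₂ (h.dgLeft_of_tildeClass hA) hQ' hQ, hB⟩

omit h [EnoughProjectives C] [EnoughInjectives C] [HasCoproductsOfShape ℕ C] in
lemma trW_of_mappingCone (P : ObjectProperty (CochainComplex C ℤ)) [(homotopySubcat P).IsTriangulated]
    {K L : CochainComplex C ℤ} (f : K ⟶ L) (hf : P (mappingCone f)) :
    (homotopySubcat P).trW ((HomotopyCategory.quotient C _).map f) :=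
  ObjectProperty.trW.mk _ (HomotopyCategory.mappingCone_triangleh_distinguished f) hf

theorem CHPair.triangleEquivalent_left [(homotopySubcat (dgLeft X Y)).IsTriangulated] :
    TriangleEquivalent (fullTriangSubcat (homotopySubcat (dgLeft X Y)))
      (verdierQuotient (homotopySubcat (rac X))) := by
  refine triangleEquivalent_of_leftOrthogonal _ _ (fun K hK L f hL => ?_) fun M => ?_
  · obtain ⟨K, rfl⟩ := HomotopyCategory.quotient_obj_surjective K
    obtain ⟨L, rfl⟩ := HomotopyCategory.quotient_obj_surjective L
    obtain ⟨f, rfl⟩ := (HomotopyCategory.quotient C (ComplexShape.up ℤ)).map_surjective f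
    exact (homotopy_iff _ _ _).1 (h.homotopy_zero_of_dgLeft hK hL f)
  · obtain ⟨M, rfl⟩ := HomotopyCategory.quotient_obj_surjective M
    obtain ⟨B, N, j, p, w, hS, hN, hB⟩ := h.exists_dgLeft_precover M
    exact ⟨(HomotopyCategory.quotient C _).obj N, (HomotopyCategory.quotient C _).map p, hN,
      trW_of_mappingCone _ p (h.rac_mappingCone hS hB)⟩

end Precover

/-! ### The dual statements -/

section Dual

open Opposite HomologicalComplex CochainComplex

variable {C : Type u} [Category.{v} C] [Abelian C]

/-- The complex in the opposite category attached to a complex. -/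
abbrev opc (K : CochainComplex C ℤ) : CochainComplex Cᵒᵖ ℤ := (CochainComplex.opEquivalence C).functor.obj (op K)

/-- The morphism in the opposite category attached to a morphism of complexes. -/
abbrev opcMap {K L : CochainComplex C ℤ} (f : K ⟶ L) : opc L ⟶ opc K :=
  (CochainComplex.opEquivalence C).functor.map f.op

lemma opcMap_zero (K L : CochainComplex C ℤ) : opcMap (0 : K ⟶ L) = 0 :=
  (CochainComplex.opEquivalence C).functor.map_zero _ _

lemma nonempty_homotopy_opcMap_iff {K L : CochainComplex C ℤ} (f : K ⟶ L) :
    Nonempty (Homotopy (opcMap f) 0) ↔ Nonempty (Homotopy f 0) :=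
  ⟨fun ⟨H⟩ => ⟨homotopyUnop (H.trans (Homotopy.ofEq (opcMap_zero K L).symm))⟩,
    fun ⟨H⟩ => ⟨(homotopyOp H).trans (Homotopy.ofEq (opcMap_zero K L))⟩⟩

lemma exists_opc_iso (N : CochainComplex Cᵒᵖ ℤ) :
    ∃ K : CochainComplex C ℤ, Nonempty (opc K ≅ N) :=
  ⟨((CochainComplex.opEquivalence C).inverse.obj N).unop, ⟨(CochainComplex.opEquivalence C).counitIso.app N⟩⟩

lemma opcMap_surjective {K L : CochainComplex C ℤ} (g : opc L ⟶ opc K) :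
    ∃ f : K ⟶ L, opcMap f = g :=
  ⟨((CochainComplex.opEquivalence C).functor.preimage g).unop, (CochainComplex.opEquivalence C).functor.map_preimage g⟩

lemma acyclic_opc_iff (K : CochainComplex C ℤ) : (opc K).Acyclic ↔ K.Acyclic := by
  refine ⟨fun hK n => ?_, acyclic_op⟩
  obtain ⟨m, rfl⟩ : ∃ m, n = -m := ⟨-n, by simp⟩
  have := hK m
  rw [exactAt_iff' _ (m - 1) m (m + 1) (by simp) (by simp)] at this
  rw [exactAt_iff' _ (-(m + 1)) (-m) (-(m - 1)) (by simp; lia) (by simp; lia)]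
  exact (ShortComplex.exact_op_iff _).1 this

/-- The cycles of acyclic complexes are cokernels. -/
lemma nonempty_iso_cycles {K : CochainComplex C ℤ} (hK : K.Acyclic) {i j k : ℤ} (hij : i + 1 = j)
    (hjk : j + 1 = k) {Q : C} {π : K.X j ⟶ Q} [Epi π] {z : K.d i j ≫ π = 0}
    (h : (ShortComplex.mk _ _ z).Exact) : Nonempty (Q ≅ K.cycles k) := by
  subst hij hjk
  have hS := shortExact_cycles hK (i + 1)
  have : Epi (K.toCycles i (i + 1)) := (shortExact_cycles hK i).epi_g
  have : Epi (K.toCycles (i + 1) (i + 1 + 1)) := hS.epi_g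
  have h₁ : K.iCycles (i + 1) ≫ π = 0 := by
    rw [← cancel_epi (K.toCycles i (i + 1)), comp_zero, K.toCycles_i_assoc, z]
  have h₂ : K.d i (i + 1) ≫ K.toCycles (i + 1) (i + 1 + 1) = 0 := by
    rw [← cancel_mono (K.iCycles _)]
    simp
  refine ⟨⟨h.desc _ h₂, hS.exact.desc _ h₁, ?_, ?_⟩⟩
  · rw [← cancel_epi π]
    refine (Category.assoc _ _ _).symm.trans ((congrArg (· ≫ _) (h.g_desc _ h₂)).trans
      ((hS.exact.g_desc _ h₁).trans (Category.comp_id _).symm))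
  · rw [← cancel_epi (K.toCycles (i + 1) (i + 1 + 1))]
    refine (Category.assoc _ _ _).symm.trans ((congrArg (· ≫ _) (hS.exact.g_desc _ h₁)).trans
      ((h.g_desc _ h₂).trans (Category.comp_id _).symm))

/-- Cycles in the opposite category are cokernels of differentials, and for an acyclic complex these
are the cycles one degree higher: degree m of `opc K` corresponds to degree -m + 1 of `K`. -/
lemma tildeClass_opc_iff (P : ObjectProperty C) [P.IsClosedUnderIsomorphisms]
    (K : CochainComplex C ℤ) : tildeClass P.op (opc K) ↔ tildeClass P K := by
  have key (hK : K.Acyclic) (i j k m : ℤ) (hij : i + 1 = j) (hjk : j + 1 = k) (hjm : j = -m) :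
      Nonempty (((opc K).cycles m).unop ≅ K.cycles k) := by
    obtain rfl : i = -(m + 1) := by lia
    subst hjm
    let e := (opc K).cyclesIsKernel m (m + 1) (by simp)
    have hT : (ShortComplex.mk ((opc K).iCycles m) ((opc K).d m (m + 1)) (by simp)).Exact :=
      ShortComplex.exact_of_f_is_kernel _ e
    let π : K.X (-m) ⟶ ((opc K).cycles m).unop := ((opc K).iCycles m).unop
    have : Epi π := unop_epi_of_mono ((opc K).iCycles m)
    exact nonempty_iso_cycles (π := π) hK hij hjk hT.unop
  constructor
  · intro h
    have hK := (acyclic_opc_iff K).1 h.1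
    refine ⟨hK, fun k => ?_⟩
    obtain ⟨e⟩ := key hK (k - 1 - 1) (k - 1) k (-(k - 1)) (by lia) (by lia) (by lia)
    exact P.prop_of_iso e (h.2 _)
  · intro h
    refine ⟨(acyclic_opc_iff K).2 h.1, fun m => ?_⟩
    obtain ⟨e⟩ := key h.1 (-m - 1) (-m) (-m + 1) m (by lia) (by lia) rfl
    exact P.prop_of_iso e.symm (h.2 _)

lemma tildeClass_of_iso (P : ObjectProperty C) [P.IsClosedUnderIsomorphisms]
    {K L : CochainComplex C ℤ} (e : K ≅ L) (hK : tildeClass P K) : tildeClass P L :=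
  ⟨fun n => (hK.1 n).of_iso e, fun n => P.prop_of_iso ((cyclesFunctor C _ n).mapIso e) (hK.2 n)⟩

lemma dgLeft_of_iso {X Y : ObjectProperty C} [X.IsClosedUnderIsomorphisms]
    {K L : CochainComplex C ℤ} (e : K ≅ L) (hK : dgLeft X Y K) : dgLeft X Y L := by
  refine ⟨fun n => X.prop_of_iso ((eval C _ n).mapIso e) (hK.1 n), fun N hN f => ?_⟩
  obtain ⟨H⟩ := hK.2 N hN (e.hom ≫ f)
  exact ⟨(Homotopy.ofEq (by simp)).trans ((H.compLeft e.inv).trans (Homotopy.ofEq (by simp)))⟩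

lemma dgLeft_opc_iff {X Y : ObjectProperty C} [X.IsClosedUnderIsomorphisms]
    (K : CochainComplex C ℤ) : dgLeft Y.op X.op (opc K) ↔ dgRight X Y K := by
  constructor
  · intro h
    refine ⟨fun n => ?_, fun N hN f => ?_⟩
    · obtain ⟨m, rfl⟩ : ∃ m, n = -m := ⟨-n, by simp⟩
      exact h.1 m
    · rw [← nonempty_homotopy_opcMap_iff]
      exact h.2 _ ((tildeClass_opc_iff X N).2 hN) _
  · intro h
    refine ⟨fun n => h.1 (-n), fun N hN f => ?_⟩
    obtain ⟨N', ⟨e⟩⟩ := exists_opc_iso N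
    obtain ⟨g, hg⟩ := opcMap_surjective (f ≫ e.inv)
    obtain ⟨H⟩ := (nonempty_homotopy_opcMap_iff g).2
      (h.2 N' ((tildeClass_opc_iff X N').1 (tildeClass_of_iso X.op e.symm hN)) g)
    exact ⟨(Homotopy.ofEq (by simp [hg])).trans ((H.compRight e.hom).trans
      (Homotopy.ofEq (by simp)))⟩

lemma rac_opc_iff (Y : ObjectProperty C) (K : CochainComplex C ℤ) :
    rac Y.op (opc K) ↔ lac Y K := by
  constructor
  · intro h B hB i j k hij hjk x
    obtain ⟨i, rfl⟩ : ∃ m, i = -m := ⟨-i, by simp⟩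
    obtain ⟨j, rfl⟩ : ∃ m, j = -m := ⟨-j, by simp⟩
    obtain ⟨k, rfl⟩ : ∃ m, k = -m := ⟨-k, by simp⟩
    have := h (op B) hB k j i (by lia) (by lia) x.op
    constructor
    · intro hx
      obtain ⟨y, hy⟩ := this.1 (congrArg Quiver.Hom.op hx)
      exact ⟨y.unop, congrArg Quiver.Hom.unop hy⟩
    · rintro ⟨y, rfl⟩
      simp
  · intro h B hB i j k hij hjk x
    have := h B.unop hB (-k) (-j) (-i) (by lia) (by lia) x.unop
    constructor
    · intro hx
      obtain ⟨y, hy⟩ := this.1 (congrArg Quiver.Hom.unop hx)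
      exact ⟨y.op, congrArg Quiver.Hom.op hy⟩
    · rintro ⟨y, rfl⟩
      simp

lemma lac_opc_iff (X : ObjectProperty C) (K : CochainComplex C ℤ) :
    lac X.op (opc K) ↔ rac X K := by
  constructor
  · intro h B hB i j k hij hjk x
    obtain ⟨i, rfl⟩ : ∃ m, i = -m := ⟨-i, by simp⟩
    obtain ⟨j, rfl⟩ : ∃ m, j = -m := ⟨-j, by simp⟩
    obtain ⟨k, rfl⟩ : ∃ m, k = -m := ⟨-k, by simp⟩
    have := h (op B) hB k j i (by lia) (by lia) x.op
    constructor
    · intro hx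
      obtain ⟨y, hy⟩ := this.1 (congrArg Quiver.Hom.op hx)
      exact ⟨y.unop, congrArg Quiver.Hom.unop hy⟩
    · rintro ⟨y, rfl⟩
      simp
  · intro h B hB i j k hij hjk x
    have := h B.unop hB (-k) (-j) (-i) (by lia) (by lia) x.unop
    constructor
    · intro hx
      obtain ⟨y, hy⟩ := this.1 (congrArg Quiver.Hom.unop hx)
      exact ⟨y.op, congrArg Quiver.Hom.op hy⟩
    · rintro ⟨y, rfl⟩
      simp

variable {X Y : ObjectProperty C} (h : CHPair X Y)

include h

lemma CHPair.lac_of_tildeClass {A : CochainComplex C ℤ} (hA : tildeClass X A) : lac Y A := by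
  rintro B hB i _ _ rfl rfl c
  constructor
  · intro hc
    dsimp at hc
    have : Epi (A.toCycles i (i + 1)) := (shortExact_cycles hA.1 i).epi_g
    have := (shortExact_cycles hA.1 (i + 1)).epi_g
    have hc' : A.iCycles (i + 1) ≫ c = 0 := by
      rw [← cancel_epi (A.toCycles i (i + 1)), A.toCycles_i_assoc, hc, comp_zero]
    obtain ⟨l, hl⟩ := h.extend (shortExact_cycles hA.1 (i + 1 + 1)) (hA.2 _) hB
      ((shortExact_cycles hA.1 (i + 1)).exact.desc c hc')
    refine ⟨l, ?_⟩
    dsimp at hl ⊢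
    rw [← A.toCycles_i, Category.assoc, hl]
    exact (shortExact_cycles hA.1 (i + 1)).exact.g_desc _ _
  · rintro ⟨l, rfl⟩
    simp

/-- Dual in content to `CHPair.rac_mappingCone`, with a direct computation that avoids identifying
the opposite of a cone. A cocycle on the cone has coordinates a on `M` and e on `I`; extend a to t
on `I`, and e - dt then descends to a cocycle on `A`, which bounds. -/
lemma CHPair.lac_mappingCone {M I A : CochainComplex C ℤ} {f : M ⟶ I} {q : I ⟶ A} {w : f ≫ q = 0}
    (hS : (ShortComplex.mk f q w).ShortExact) (hA : tildeClass X A) : lac Y (mappingCone f) := by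
  rintro B hB i _ _ rfl rfl x
  constructor
  · intro hx
    dsimp at hx
    let a : M.X (i + 1 + 1) ⟶ B := (mappingCone.inl f).v (i + 1 + 1) (i + 1) (by lia) ≫ x
    let e : I.X (i + 1) ⟶ B := (mappingCone.inr f).f (i + 1) ≫ x
    have ha : f.f (i + 1) ≫ e = M.d (i + 1) (i + 1 + 1) ≫ a := by
      have := mappingCone.inl_v_d f (i + 1) i (i + 1 + 1) (by lia) (by lia) =≫ x
      rw [Category.assoc, hx, comp_zero, Preadditive.sub_comp, Category.assoc, Category.assoc] at this
      exact (sub_eq_zero.1 this.symm)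
    have he : I.d i (i + 1) ≫ e = 0 := by
      have := (mappingCone.inr f).comm i (i + 1) =≫ x
      rw [Category.assoc, hx, comp_zero, Category.assoc] at this
      exact this.symm
    obtain ⟨t, ht⟩ := h.extend (shortExact_f hS (i + 1 + 1)) (h.prop_X_of_tildeClass_left hA _) hB a
    have ht' : f.f (i + 1 + 1) ≫ t = a := ht
    have hq : Epi (q.f i) := (shortExact_f hS i).epi_g
    have he' : f.f (i + 1) ≫ (e - I.d (i + 1) (i + 1 + 1) ≫ t) = 0 := by
      rw [Preadditive.comp_sub, ha, f.comm_assoc, ht', sub_self]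
    have := (shortExact_f hS (i + 1)).epi_g
    let c : A.X (i + 1) ⟶ B := (shortExact_f hS (i + 1)).exact.desc _ he'
    have hc : q.f (i + 1) ≫ c = e - I.d (i + 1) (i + 1 + 1) ≫ t :=
      (shortExact_f hS (i + 1)).exact.g_desc _ _
    have hdc : A.d i (i + 1) ≫ c = 0 := by
      rw [← cancel_epi (q.f i), q.comm_assoc, hc, Preadditive.comp_sub, he]
      simp
    obtain ⟨c', hc'⟩ := (h.lac_of_tildeClass hA B hB i (i + 1) (i + 1 + 1) rfl rfl c).1 hdc
    dsimp at hc'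
    have hfq : f.f (i + 1 + 1) ≫ q.f (i + 1 + 1) = 0 := by
      rw [← comp_f, w, zero_f]
    refine ⟨(mappingCone.snd f).v (i + 1 + 1) (i + 1 + 1) (by lia) ≫
      (t + q.f (i + 1 + 1) ≫ c'), ?_⟩
    dsimp
    have h₁ : f.f (i + 1 + 1) ≫ (t + q.f (i + 1 + 1) ≫ c') = a := by
      rw [Preadditive.comp_add, ht', reassoc_of% hfq, zero_comp, add_zero]
    have h₂ : I.d (i + 1) (i + 1 + 1) ≫ (t + q.f (i + 1 + 1) ≫ c') = e := by
      rw [Preadditive.comp_add, ← q.comm_assoc, hc', hc]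
      abel
    rw [reassoc_of% mappingCone.d_snd_v f (i + 1) (i + 1 + 1) rfl, Preadditive.add_comp,
      Category.assoc, Category.assoc, h₁, h₂]
    conv_rhs => rw [← Category.id_comp x, ← mappingCone.id_X f (i + 1) (i + 1 + 1) rfl]
    simp [a, e]
  · rintro ⟨l, rfl⟩
    simp

variable [EnoughProjectives Cᵒᵖ] [EnoughInjectives Cᵒᵖ] [HasCoproductsOfShape ℕ Cᵒᵖ]

/-- Complexes have special preenvelopes by complexes in `dgRight X Y`. -/
lemma CHPair.exists_dgRight_preenvelope (M : CochainComplex C ℤ) :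
    ∃ (I A : CochainComplex C ℤ) (f : M ⟶ I) (q : I ⟶ A) (w : f ≫ q = 0),
      (ShortComplex.mk f q w).ShortExact ∧ dgRight X Y I ∧ tildeClass X A := by
  have := h.iso_left
  have := h.iso_right
  obtain ⟨B, N, j, p, w, hS, hN, hB⟩ := h.op.exists_dgLeft_precover (opc M)
  let E := CochainComplex.opEquivalence C
  have hS' : (ShortComplex.mk _ _ w |>.map E.inverse).unop.ShortExact :=
    (hS.map_of_exact E.inverse).unop
  let e : M ≅ (E.inverse.obj (opc M)).unop := (E.unitIso.app (Opposite.op M)).unop.symm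
  let f : M ⟶ (E.inverse.obj N).unop := e.hom ≫ (E.inverse.map p).unop
  let q : (E.inverse.obj N).unop ⟶ (E.inverse.obj B).unop := (E.inverse.map j).unop
  have hfq : f ≫ q = 0 := by
    rw [Category.assoc]
    exact (congrArg (e.hom ≫ ·) (ShortComplex.mk _ _ w |>.map E.inverse).unop.zero).trans comp_zero
  refine ⟨_, _, f, q, hfq, ?_, ?_, ?_⟩
  · exact ShortComplex.shortExact_of_iso (S₁ := (ShortComplex.mk _ _ w |>.map E.inverse).unop)
      (S₂ := ShortComplex.mk f q hfq) (ShortComplex.isoMk e.symm (Iso.refl _) (Iso.refl _)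
      ((e.inv_hom_id_assoc _).trans (Category.comp_id _).symm)
      ((Category.id_comp _).trans (Category.comp_id _).symm)) hS'
  · exact (dgLeft_opc_iff _).1 (dgLeft_of_iso (E.counitIso.app N).symm hN)
  · exact (tildeClass_opc_iff X _).1 (tildeClass_of_iso X.op (E.counitIso.app B).symm hB)

theorem CHPair.triangleEquivalent_right [(homotopySubcat (dgRight X Y)).IsTriangulated] :
    TriangleEquivalent (fullTriangSubcat (homotopySubcat (dgRight X Y)))
      (verdierQuotient (homotopySubcat (lac Y))) := by
  have := h.iso_left
  refine triangleEquivalent_of_rightOrthogonal _ _ (fun K hK L f hL => ?_) fun M => ?_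
  · obtain ⟨K, rfl⟩ := HomotopyCategory.quotient_obj_surjective K
    obtain ⟨L, rfl⟩ := HomotopyCategory.quotient_obj_surjective L
    obtain ⟨f, rfl⟩ := (HomotopyCategory.quotient C (ComplexShape.up ℤ)).map_surjective f
    refine (homotopy_iff _ _ _).1 ((nonempty_homotopy_opcMap_iff f).1 ?_)
    exact h.op.homotopy_zero_of_dgLeft ((dgLeft_opc_iff K).2 hK) ((rac_opc_iff Y L).2 hL) _
  · obtain ⟨M, rfl⟩ := HomotopyCategory.quotient_obj_surjective M
    obtain ⟨I, A, f, q, w, hS, hI, hA⟩ := h.exists_dgRight_preenvelope M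
    exact ⟨(HomotopyCategory.quotient C _).obj I, (HomotopyCategory.quotient C _).map f, hI,
      trW_of_mappingCone _ f (h.lac_mappingCone hS hA)⟩

end Dual

/-! ### Cotorsion triples -/

section Triple

variable {C : Type u} [Category.{v} C] [Abelian C] {X Z Y : ObjectProperty C}

/-- As the right class of the first pair, `Z` contains the cokernel of I ⟶ E(I), an embedding into
an injective; since `I` is in `Y`, the second pair splits this embedding. -/
lemma injective_of_chPair [EnoughInjectives C] (h : CHPair X Z) (h' : CHPair Z Y) {I : C}
    (hZ : Z I) (hY : Y I) : Injective I := by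
  let S := ShortComplex.mk (Injective.ι I) (cokernel.π (Injective.ι I)) (cokernel.condition _)
  have hS : S.ShortExact :=
    { exact := ShortComplex.exact_cokernel _
      mono_f := inferInstanceAs (Mono (Injective.ι I))
      epi_g := inferInstanceAs (Epi (cokernel.π (Injective.ι I))) }
  obtain ⟨r, hr⟩ := h'.extend hS (h.coker_right hS hZ (h.inj _ (inferInstance : Injective (Injective.under I))))
    hY (𝟙 I)
  have hr' : Injective.ι I ≫ r = 𝟙 I := hr
  refine ⟨fun {V W} g m _ => ⟨Injective.factorThru (g ≫ Injective.ι I) m ≫ r, ?_⟩⟩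
  rw [← Category.assoc, Injective.comp_factorThru, Category.assoc, hr', Category.comp_id]

/-- For a special precover 0 ⟶ Z₀ ⟶ A ⟶ N ⟶ 0, the map A ⟶ N lifts to `M` by `hq`, so `M` is the
pushout of K ⟵ Z₀ ⟶ A. Extending `f` to `M` thus reduces to extending a map Z₀ ⟶ B to `A`. -/
lemma exists_extension_of_triple [EnoughInjectives C] (h : CHPair X Z) (h' : CHPair Z Y)
    {K M N : C} {i : K ⟶ M} {q : M ⟶ N} {w : i ≫ q = 0} (hS : (ShortComplex.mk i q w).ShortExact)
    (hq : ∀ {T : C}, X T → ∀ t : T ⟶ N, ∃ s : T ⟶ M, s ≫ q = t) {B : C} (hB : Y B) (f : K ⟶ B) :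
    ∃ F : M ⟶ B, i ≫ F = f := by
  have : Mono i := hS.mono_f
  obtain ⟨Z₀, A, b, a, hba, hA, hXA, hZ₀⟩ := h.complete_left N
  have : Mono b := hA.mono_f
  have : Epi a := hA.epi_g
  obtain ⟨s, hs⟩ := hq hXA a
  have hbs : (b ≫ s) ≫ q = 0 := by rw [Category.assoc, hs, hba]
  let g : Z₀ ⟶ K := hS.exact.lift _ hbs
  have hg : g ≫ i = b ≫ s := hS.exact.lift_f _ _
  -- The special `Z`-precover `Z₁` of `B` is also in `Y`, hence injective. The map from `Z₀` lifts
  -- to `Z₁`, and from there extends to `A`.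
  obtain ⟨l, hl⟩ : ∃ l : A ⟶ B, b ≫ l = g ≫ f := by
    obtain ⟨Y₁, Z₁, y, z, hyz, hZ, hZ₁, hY₁⟩ := h'.complete_left B
    have : Injective Z₁ := injective_of_chPair h h' hZ₁ (h'.ext_right hZ hY₁ hB)
    obtain ⟨g', hg'⟩ := h'.lift hZ hY₁ hZ₀ (g ≫ f)
    refine ⟨Injective.factorThru g' b ≫ z, ?_⟩
    rw [← Category.assoc, Injective.comp_factorThru]
    exact hg'
  let π : K ⊞ A ⟶ M := biprod.desc i s
  have hπ : Epi π := by
    rw [epi_iff_surjective_up_to_refinements]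
    intro T m
    obtain ⟨T', p, hp, t, ht⟩ := surjective_up_to_refinements_of_epi a (m ≫ q)
    have hk : (p ≫ m - t ≫ s) ≫ q = 0 := by
      rw [Preadditive.sub_comp, Category.assoc, Category.assoc, hs, ht, sub_self]
    have hk' : hS.exact.lift _ hk ≫ i = p ≫ m - t ≫ s := hS.exact.lift_f _ _
    exact ⟨T', p, hp, biprod.lift (hS.exact.lift _ hk) t, by simp [π, hk']⟩
  -- The kernel of K ⊞ A ⟶ M is parametrized by Z₀ through (-g, b), on which `f` and `l` cancel by
  -- the choice of `l`.
  have hker : kernel.ι π ≫ biprod.desc f l = 0 := by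
    obtain ⟨x₁, x₂, hx⟩ : ∃ x₁ x₂, kernel.ι π = biprod.lift x₁ x₂ :=
      ⟨kernel.ι π ≫ biprod.fst, kernel.ι π ≫ biprod.snd, by ext <;> simp⟩
    have hx₀ : x₁ ≫ i + x₂ ≫ s = 0 := by
      have := kernel.condition π
      rwa [hx, biprod.lift_desc] at this
    have hx₂ : x₂ ≫ a = 0 := by
      have := hx₀ =≫ q
      rwa [Preadditive.add_comp, Category.assoc, Category.assoc, w, hs, comp_zero, zero_add,
        zero_comp] at this
    let z : kernel π ⟶ Z₀ := hA.exact.lift x₂ hx₂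
    have hz : z ≫ b = x₂ := hA.exact.lift_f _ _
    have hx₁ : x₁ = -(z ≫ g) := by
      rw [← cancel_mono i, Preadditive.neg_comp, Category.assoc, hg, reassoc_of% hz]
      exact eq_neg_of_add_eq_zero_left hx₀
    rw [hx, biprod.lift_desc, hx₁, ← hz, Category.assoc, hl, Preadditive.neg_comp, Category.assoc,
      neg_add_cancel]
  have hex := ShortComplex.exact_kernel π
  refine ⟨hex.desc _ hker, ?_⟩
  have : π ≫ hex.desc _ hker = biprod.desc f l := hex.g_desc _ _
  simpa [π] using (biprod.inl : K ⟶ K ⊞ A) ≫= this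

/-- Being X-rac makes each sequence of cycles exact under Hom(X, -), hence under Hom(-, Y). A
cocycle on the Hom complex descends to cycles and extends from there. -/
lemma lac_of_rac [EnoughInjectives C] [EnoughProjectives C] (h : CHPair X Z) (h' : CHPair Z Y)
    {K : CochainComplex C ℤ} (hK : rac X K) : lac Y K := by
  have hK' := h.acyclic_of_rac hK
  rintro B hB i _ _ rfl rfl c
  constructor
  · intro hc
    dsimp at hc
    have : Epi (K.toCycles i (i + 1)) := (shortExact_cycles hK' i).epi_g
    have := (shortExact_cycles hK' (i + 1)).epi_g
    have hc' : K.iCycles (i + 1) ≫ c = 0 := by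
      rw [← cancel_epi (K.toCycles i (i + 1)), K.toCycles_i_assoc, hc, comp_zero]
    obtain ⟨l, hl⟩ := exists_extension_of_triple h h' (shortExact_cycles hK' (i + 1 + 1))
      (fun {T} hT t => by
        obtain ⟨s, hs⟩ := (hK T hT (i + 1 + 1) _ _ rfl rfl (t ≫ K.iCycles _)).1 (by simp)
        refine ⟨s, ?_⟩
        rw [← cancel_mono (K.iCycles _), Category.assoc, K.toCycles_i]
        exact hs) hB ((shortExact_cycles hK' (i + 1)).exact.desc c hc')
    refine ⟨l, ?_⟩
    dsimp
    rw [← K.toCycles_i, Category.assoc, hl]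
    exact (shortExact_cycles hK' (i + 1)).exact.g_desc _ _
  · rintro ⟨l, rfl⟩
    simp

/-- The reverse inclusion is `lac_of_rac` for the opposite triple, in which X and Y trade places. -/
lemma rac_eq_lac [EnoughInjectives C] [EnoughProjectives C] [EnoughInjectives Cᵒᵖ]
    [EnoughProjectives Cᵒᵖ] (h : CHPair X Z) (h' : CHPair Z Y) : rac X = lac Y := by
  ext K
  refine ⟨lac_of_rac h h', fun hK => ?_⟩
  exact (lac_opc_iff X K).1 (lac_of_rac h'.op h.op ((rac_opc_iff Y K).2 hK))

end Triple

end

end RelDer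

/-! ### Application to module categories. -/

theorem mainTheorem3 (R : Type u) [Ring R] :
    (∀ (X : ObjectProperty (ModuleCat.{u} R))
        (h : RelDer.IsCompleteHereditaryCotorsionPair.{u} X (RelDer.rightPerp.{u} X)),
      RelDer.TriangleEquivalent (RelDer.KdgLeft h.toIsCotorsionPair) (RelDer.relDerivedLeft X)) ∧
    (∀ (Y : ObjectProperty (ModuleCat.{u} R))
        (h : RelDer.IsCompleteHereditaryCotorsionPair.{u} (RelDer.leftPerp.{u} Y) Y),
      RelDer.TriangleEquivalent (RelDer.KdgRight h.toIsCotorsionPair)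
        (RelDer.relDerivedRight Y)) ∧
    (∀ (X Z Y : ObjectProperty (ModuleCat.{u} R))
        (h : RelDer.IsCompleteHereditaryCotorsionTriple.{u} X Z Y),
      RelDer.TriangleEquivalent (RelDer.KdgLeft h.left.toIsCotorsionPair)
          (RelDer.relDerivedLeft X) ∧
        RelDer.homotopySubcat (RelDer.rac X) = RelDer.homotopySubcat (RelDer.lac Y) ∧
        RelDer.relDerivedLeft X = RelDer.relDerivedRight Y ∧
        RelDer.TriangleEquivalent (RelDer.relDerivedRight Y)
          (RelDer.KdgRight h.right.toIsCotorsionPair) ∧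
        RelDer.TriangleEquivalent (RelDer.KdgLeft h.left.toIsCotorsionPair)
          (RelDer.KdgRight h.right.toIsCotorsionPair)) := by
  have hl (X Y : ObjectProperty (ModuleCat.{u} R))
      (h : RelDer.IsCompleteHereditaryCotorsionPair.{u} X Y) :
      RelDer.TriangleEquivalent (RelDer.KdgLeft h.toIsCotorsionPair) (RelDer.relDerivedLeft X) :=
    have := RelDer.isTriangulated_dgLeft h.toIsCotorsionPair
    h.chPair.triangleEquivalent_left
  have hr (X Y : ObjectProperty (ModuleCat.{u} R))
      (h : RelDer.IsCompleteHereditaryCotorsionPair.{u} X Y) :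
      RelDer.TriangleEquivalent (RelDer.KdgRight h.toIsCotorsionPair) (RelDer.relDerivedRight Y) :=
    have := RelDer.isTriangulated_dgRight h.toIsCotorsionPair
    h.chPair.triangleEquivalent_right
  refine ⟨fun X h => hl _ _ h, fun Y h => hr _ _ h, fun X Z Y h => ?_⟩
  have hK : RelDer.homotopySubcat (RelDer.rac X) = RelDer.homotopySubcat (RelDer.lac Y) := by
    rw [RelDer.rac_eq_lac h.left.chPair h.right.chPair]
  have hD : RelDer.relDerivedLeft X = RelDer.relDerivedRight Y := RelDer.verdierQuotient_congr hK
  have h₁ := hl _ _ h.left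
  have h₂ := (hr _ _ h.right).symm
  exact ⟨h₁, hK, hD, h₂, (hD ▸ h₁).trans h₂⟩
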